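/- Let $K$ be a field, $G$ a finite abelian group (written multiplicatively) and $A=KG$ its group algebra. For $n\ge 0$ let $C^n(A)=\mathrm{Hom}_K(A^{\otimes n},A)$ be the Hochschild cochains with the Hochschild differential $\delta$, and $HH^n(A)$ their cohomology. For $f\in C^n(A)$, $g\in C^m(A)$ put $$(f\circ_i g)(x_1\otimes\cdots\otimes x_{n+m-1})=f(x_1\otimes\cdots\otimes g(x_i\otimes\cdots\otimes x_{i+m-1})\otimes\cdots\otimes x_{n+m-1}),\qquad 1\le i\le n,$$ $$f\circ g=\sum_{i=1}^{n}(-1)^{(i-1)(m-1)}f\circ_i g,\qquad [f,g]_G=f\circ g-(-1)^{(n-1)(m-1)}g\circ f .$$ The Gerstenhaber bracket on $HH^{*+1}(A)$ is the bilinear bracket induced by $[-,-]_G$ on cocycles; here $HH^n(A)$ is placed in degree $n-1$. Let $H^n(G,K)$ be the group cohomology of $G$ with coefficients in the trivial module $K$, computed by inhomogeneous cochains $\mathrm{Map}(G^{\times n},K)$. For $\alpha\in\mathrm{Map}(G^{\times n},K)$, $\beta\in\mathrm{Map}(G^{\times m},K)$ and $y\in G$ let $$\gamma_\alpha^{(\beta,y)}(x_1|\cdots|x_{n+m-1})=\sum_{i=1}^{n}(-1)^{(m-1)(i-1)}\,\alpha(x_1|\cdots|x_{i-1}|x_ix_{i+1}\cdots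 x_{i+m-1}\,y\,|x_{i+m}|\cdots|x_{n+m-1})\;\beta(x_i|\cdots|x_{i+m-1}),$$ and consider the bilinear map $\mathrm{Map}(G^{\times n},K)\otimes A\times \mathrm{Map}(G^{\times m},K)\otimes A\to \mathrm{Map}(G^{\times n+m-1},K)\otimes A$ given for $x,y\in G$ by $$[\alpha\otimes x,\beta\otimes y]=\bigl(\gamma_\alpha^{(\beta,y)}-(-1)^{(n-1)(m-1)}\gamma_\beta^{(\alpha,x)}\bigr)\otimes xy$$ (it is zero for $n=m=0$). Then: 1. This bracket is well defined on $H^{*+1}(G,K)\otimes A$: if $\alpha$ and $\beta$ are cocycles then $\gamma_\alpha^{(\beta,y)}-(-1)^{(n-1)(m-1)}\gamma_\beta^{(\alpha,x)}$ is a cocycle, and there is a unique bilinear bracket on $\bigoplus_{n\ge0}H^n(G,K)\otimes A$ whose value on the pair $([\alpha]\otimes x,[\beta]\otimes y)$ is the class of that cocycle tensored with $xy$. 2. With this bracket, and with $H^n(G,K)\otimes A$ placed in degree $n-1$, $H^{*+1}(G,K)\otimes A$ is a graded Lie algebra. 3. The Gerstenhaber bracket is likewise well defined on $HH^{*+1}(A)$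 and makes it a graded Lie algebra, and $HH^{*+1}(A)$ with the Gerstenhaber bracket is isomorphic, as a graded Lie algebra, to $H^{*+1}(G,K)\otimes A$ with the bracket above. Here a graded Lie algebra is a $\mathbb Z$-graded $K$-vector space with a bilinear bracket of degree $0$ such that, for homogeneous $a,b,c$, $[a,b]=-(-1)^{|a||b|}[b,a]$ and $[a,[b,c]]=[[a,b],c]+(-1)^{|a||b|}[b,[a,c]]$, and moreover $[a,a]=0$ for $|a|$ even and $[a,[a,a]]=0$ for $|a|$ odd (conditions that matter only in characteristics $2$ and $3$). -/

import Mathlib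

open scoped DirectSum TensorProduct

universe u

set_option maxSynthPendingDepth 3

/-! ### Graded Lie algebras -/

/-- `(L, B)` is a graded Lie algebra (with the usual signs) for the grading `𝓛` of `L`:
the bracket has degree zero, is graded antisymmetric and satisfies the graded Jacobi identity.
The fields `bracket_self` and `bracket_bracket_self` follow from the others when `2`,
respectively `3`, is invertible; they are the usual extra axioms over arbitrary fields. -/
structure IsGradedLieAlgebra {K L : Type*} [Field K] [AddCommGroup L] [Module K L]
    (𝓛 : ℤ → Submodule K L) (B : L →ₗ[K] L →ₗ[K] L) : Prop where
  isInternal : DirectSum.IsInternal 𝓛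
  bracket_mem : ∀ {i j : ℤ} {x y : L}, x ∈ 𝓛 i → y ∈ 𝓛 j → B x y ∈ 𝓛 (i + j)
  antisymm : ∀ {i j : ℤ} {x y : L}, x ∈ 𝓛 i → y ∈ 𝓛 j →
    B x y = -((i * j).negOnePow • B y x)
  jacobi : ∀ {i j k : ℤ} {x y z : L}, x ∈ 𝓛 i → y ∈ 𝓛 j → z ∈ 𝓛 k →
    B x (B y z) = B (B x y) z + (i * j).negOnePow • B y (B x z)
  bracket_self : ∀ {i : ℤ} {x : L}, Even i → x ∈ 𝓛 i → B x x = 0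
  bracket_bracket_self : ∀ {i : ℤ} {x : L}, Odd i → x ∈ 𝓛 i → B x (B x x) = 0

/-- `e` is an isomorphism of graded Lie algebras: a linear isomorphism that preserves degrees
and brackets. -/
structure IsGradedLieIso {K L L' : Type*} [Field K] [AddCommGroup L] [Module K L]
    [AddCommGroup L'] [Module K L']
    (𝓛 : ℤ → Submodule K L) (B : L →ₗ[K] L →ₗ[K] L)
    (𝓛' : ℤ → Submodule K L') (B' : L' →ₗ[K] L' →ₗ[K] L') (e : L ≃ₗ[K] L') : Prop where
  mem_iff : ∀ (i : ℤ) (x : L), e x ∈ 𝓛' i ↔ x ∈ 𝓛 i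
  map_bracket : ∀ x y : L, e (B x y) = B' (e x) (e y)

/-- The shifted grading `M^{*+1}` on `⨁ n, M n`: the summand `M n` sits in degree `n - 1`. -/
def shiftedGrading (K : Type*) [Field K] (M : ℕ → Type*) [∀ n, AddCommGroup (M n)]
    [∀ n, Module K (M n)] (k : ℤ) : Submodule K (⨁ n, M n) where
  carrier := {x | ∀ n : ℕ, (n : ℤ) - 1 ≠ k → x n = 0}
  add_mem' {x y} hx hy n hn := by simp [hx n hn, hy n hn]
  zero_mem' n _ := by simp
  smul_mem' c x hx n hn := by rw [DirectSum.smul_apply, hx n hn, smul_zero]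

/-! ### Substitution of a block of variables

All positions are numbered from `0`, and `N = n + m - 1` is written `N + 1 = n + m`. -/

section Substitution

variable {X : Type*} {n m N : ℕ}

/-- The block `(x_i, …, x_{i+m-1})` of `x = (x_0, …, x_{N-1})`. -/
def blockAt (h : N + 1 = n + m) (i : Fin n) (x : Fin N → X) : Fin m → X :=
  fun k => x ⟨i + k, by omega⟩

/-- The tuple `(x_0, …, x_{i-1}, a, x_{i+m}, …, x_{N-1})`: the block of length `m` starting at
position `i` is replaced by the single entry `a`. -/
def substAt (h : N + 1 = n + m) (i : Fin n) (x : Fin N → X) (a : X) : Fin n → X :=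
  fun j =>
    if h₁ : (j : ℕ) < i then x ⟨j, by omega⟩
    else if h₂ : (j : ℕ) = i then a
    else x ⟨j + m - 1, by omega⟩

/-- The new entry of `substAt h i x a` is at position `i`. -/
theorem substAt_eq_update (h : N + 1 = n + m) (i : Fin n) (x : Fin N → X) (a : X) {a' : X} :
    substAt h i x a = Function.update (substAt h i x a') i a := by
  funext j
  simp only [substAt, Function.update_apply, Fin.ext_iff]
  split_ifs <;> first | rfl | omega

/-- Changing a variable inside the block changes only the block. -/
theorem update_inside (h : N + 1 = n + m) (i : Fin n) (x : Fin N → X) (p : Fin N) (k : Fin m)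
    (hk : (p : ℕ) = i + k) (b : X) :
    blockAt h i (Function.update x p b) = Function.update (blockAt h i x) k b ∧
      ∀ a, substAt h i (Function.update x p b) a = substAt h i x a := by
  refine ⟨?_, fun a => ?_⟩
  · funext l
    simp only [blockAt, Function.update_apply, Fin.ext_iff]
    simp [hk]
  · funext j
    simp only [substAt, Function.update_apply, Fin.ext_iff]
    have := k.2
    split_ifs <;> first | rfl | omega

/-- Changing a variable outside the block changes only one entry of the substituted tuple. -/
theorem update_outside (h : N + 1 = n + m) (i : Fin n) (x : Fin N → X) (p : Fin N)
    (hp : ¬ ∃ k : Fin m, (p : ℕ) = i + k) : ∃ j : Fin n, ∀ b,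
      blockAt h i (Function.update x p b) = blockAt h i x ∧
      ∀ a, substAt h i (Function.update x p b) a = Function.update (substAt h i x a) j b := by
  have hp' : (p : ℕ) < i ∨ i + m ≤ (p : ℕ) := by
    by_contra hc
    exact hp ⟨⟨p - i, by omega⟩, by simp only; omega⟩
  have hj : (if (p : ℕ) < i then (p : ℕ) else p + 1 - m) < n := by split_ifs <;> omega
  refine ⟨⟨_, hj⟩, fun b => ⟨?_, fun a => ?_⟩⟩
  · funext l
    have hl := l.2
    simp only [blockAt, Function.update_apply, Fin.ext_iff]
    rw [if_neg (by omega)]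
  · funext j
    simp only [substAt, Function.update_apply, Fin.ext_iff]
    split_ifs <;> first | rfl | omega

end Substitution

/-! ### The Hochschild complex and the Gerstenhaber bracket -/

section Hochschild

variable (K : Type*) [Field K] (A : Type*) [Ring A] [Algebra K A]

/-- Hochschild cochains `C^n(A) = Hom_K(A^{⊗ n}, A)`, as `n`-multilinear maps. -/
abbrev HochschildCochain (n : ℕ) : Type _ := MultilinearMap K (fun _ : Fin n => A) A

variable {K A} {n m N : ℕ}

/-- The partial composition `f ∘_i g`, namely
`(f ∘_i g)(x_0, …, x_{N-1}) = f(x_0, …, g(x_i, …, x_{i+m-1}), …, x_{N-1})`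
(for `m = 0`, the element `g` of `A` is inserted at position `i`). -/
def HochschildCochain.compAt (h : N + 1 = n + m) (f : HochschildCochain K A n) (i : Fin n)
    (g : HochschildCochain K A m) : HochschildCochain K A N :=
  MultilinearMap.mk' (fun x => f (substAt h i x (g (blockAt h i x))))
    (by
      intro x p a b
      by_cases hp : ∃ k : Fin m, (p : ℕ) = i + k
      · obtain ⟨k, hk⟩ := hp
        have hu := update_inside h i x p k hk
        simp only [(hu _).1, (hu _).2, MultilinearMap.map_update_add]
        rw [substAt_eq_update h i x (_ + _) (a' := 0), MultilinearMap.map_update_add,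
          ← substAt_eq_update, ← substAt_eq_update]
      · obtain ⟨j, hj⟩ := update_outside h i x p hp
        simp only [(hj _).1, (hj _).2, MultilinearMap.map_update_add])
    (by
      intro x p c a
      by_cases hp : ∃ k : Fin m, (p : ℕ) = i + k
      · obtain ⟨k, hk⟩ := hp
        have hu := update_inside h i x p k hk
        simp only [(hu _).1, (hu _).2, MultilinearMap.map_update_smul]
        rw [substAt_eq_update h i x (c • _) (a' := 0), MultilinearMap.map_update_smul,
          ← substAt_eq_update]
      · obtain ⟨j, hj⟩ := update_outside h i x p hp
        simp only [(hj _).1, (hj _).2, MultilinearMap.map_update_smul])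

/-- `f ∘ g = ∑_i (-1)^{i (m-1)} f ∘_i g`, with `i` running over `0, …, n-1`. -/
def HochschildCochain.comp (h : N + 1 = n + m) (f : HochschildCochain K A n)
    (g : HochschildCochain K A m) : HochschildCochain K A N :=
  ∑ i : Fin n, ((i : ℤ) * ((m : ℤ) - 1)).negOnePow • f.compAt h i g

/-- The Gerstenhaber bracket `[f, g] = f ∘ g - (-1)^{(n-1)(m-1)} g ∘ f` of cochains. -/
def HochschildCochain.bracket (h : N + 1 = n + m) (f : HochschildCochain K A n)
    (g : HochschildCochain K A m) : HochschildCochain K A N :=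
  f.comp h g - (((n : ℤ) - 1) * ((m : ℤ) - 1)).negOnePow • g.comp (h.trans (add_comm n m)) f

theorem HochschildCochain.compAt_apply (h : N + 1 = n + m) (f : HochschildCochain K A n)
    (i : Fin n) (g : HochschildCochain K A m) (x : Fin N → A) :
    f.compAt h i g x = f (substAt h i x (g (blockAt h i x))) := rfl

theorem HochschildCochain.compAt_add_left (h : N + 1 = n + m) (f f' : HochschildCochain K A n)
    (i : Fin n) (g : HochschildCochain K A m) :
    (f + f').compAt h i g = f.compAt h i g + f'.compAt h i g := rfl

theorem HochschildCochain.compAt_smul_left (h : N + 1 = n + m) (c : K)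
    (f : HochschildCochain K A n) (i : Fin n) (g : HochschildCochain K A m) :
    (c • f).compAt h i g = c • f.compAt h i g := rfl

theorem HochschildCochain.compAt_add_right (h : N + 1 = n + m) (f : HochschildCochain K A n)
    (i : Fin n) (g g' : HochschildCochain K A m) :
    f.compAt h i (g + g') = f.compAt h i g + f.compAt h i g' := by
  ext x
  change f (substAt h i x (g _ + g' _)) = f (substAt h i x _) + f (substAt h i x _)
  rw [substAt_eq_update h i x (_ + _) (a' := 0), MultilinearMap.map_update_add,
    ← substAt_eq_update, ← substAt_eq_update]

theorem HochschildCochain.compAt_smul_right (h : N + 1 = n + m) (c : K)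
    (f : HochschildCochain K A n) (i : Fin n) (g : HochschildCochain K A m) :
    f.compAt h i (c • g) = c • f.compAt h i g := by
  ext x
  change f (substAt h i x (c • g _)) = c • f (substAt h i x _)
  rw [substAt_eq_update h i x (c • _) (a' := 0), MultilinearMap.map_update_smul,
    ← substAt_eq_update]

variable (K A)

/-- The Hochschild differential
`(δf)(x_0, …, x_n) = x_0 f(x_1, …, x_n) + ∑_{i<n} (-1)^{i+1} f(x_0, …, x_i x_{i+1}, …, x_n)`
`+ (-1)^{n+1} f(x_0, …, x_{n-1}) x_n`, see `hochschildDifferential_apply`. -/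
def hochschildDifferential (n : ℕ) :
    HochschildCochain K A n →ₗ[K] HochschildCochain K A (n + 1) where
  toFun f :=
    HochschildCochain.compAt (by omega) (MultilinearMap.mkPiAlgebraFin K 2 A) 1 f
    + ∑ i : Fin n, (-1 : K) ^ ((i : ℕ) + 1) •
        HochschildCochain.compAt (by omega) f i (MultilinearMap.mkPiAlgebraFin K 2 A)
    + (-1 : K) ^ (n + 1) •
        HochschildCochain.compAt (by omega) (MultilinearMap.mkPiAlgebraFin K 2 A) 0 f
  map_add' f g := by
    simp only [HochschildCochain.compAt_add_left, HochschildCochain.compAt_add_right, smul_add,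
      Finset.sum_add_distrib]
    abel
  map_smul' c f := by
    simp only [HochschildCochain.compAt_smul_left, HochschildCochain.compAt_smul_right, smul_add,
      Finset.smul_sum, RingHom.id_apply, smul_comm c]

theorem hochschildDifferential_apply (n : ℕ) (f : HochschildCochain K A n) (x : Fin (n + 1) → A) :
    hochschildDifferential K A n f x =
      x 0 * f (fun j => x j.succ)
      + ∑ i : Fin n, (-1 : K) ^ ((i : ℕ) + 1) • f (Fin.contractNth i.castSucc (· * ·) x)
      + (-1 : K) ^ (n + 1) • (f (fun j => x j.castSucc) * x (Fin.last n)) := by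
  have hd : hochschildDifferential K A n f x =
      HochschildCochain.compAt (by omega) (MultilinearMap.mkPiAlgebraFin K 2 A) 1 f x
      + (∑ i : Fin n, (-1 : K) ^ ((i : ℕ) + 1) • HochschildCochain.compAt (by omega) f i
          (MultilinearMap.mkPiAlgebraFin K 2 A) : HochschildCochain K A (n + 1)) x
      + (-1 : K) ^ (n + 1) •
        HochschildCochain.compAt (by omega) (MultilinearMap.mkPiAlgebraFin K 2 A) 0 f x := rfl
  rw [hd, sum_apply]
  simp only [smul_apply, HochschildCochain.compAt_apply, MultilinearMap.mkPiAlgebraFin_apply,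
    List.ofFn_succ, List.ofFn_zero, List.prod_cons, List.prod_nil, mul_one]
  congr 1
  · congr 1
    · congr 1
      change f _ = f _
      congr 1
      funext j
      simp only [blockAt]
      congr 1
      ext
      simp [add_comm]
    · refine Finset.sum_congr rfl fun i _ => ?_
      congr 2
      funext j
      simp only [substAt, Fin.contractNth, blockAt, Fin.val_castSucc]
      split_ifs with h₁ h₂
      · rfl
      · congr 2 <;> ext <;> simp [h₂]
      · congr 1
  · congr 2
    · change f _ = f _
      congr 1
      funext j
      simp only [blockAt]
      congr 1
      ext
      simp
    · change x _ = x _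
      congr 1
      ext
      simp

/-- Hochschild cocycles. -/
def hochschildCocycles (n : ℕ) : Submodule K (HochschildCochain K A n) :=
  LinearMap.ker (hochschildDifferential K A n)

/-- Hochschild coboundaries. -/
def hochschildCoboundaries : (n : ℕ) → Submodule K (HochschildCochain K A n)
  | 0 => ⊥
  | n + 1 => LinearMap.range (hochschildDifferential K A n)

/-- Hochschild cohomology `HH^n(A)`: cocycles modulo coboundaries. -/
abbrev HochschildCohomology (n : ℕ) : Type _ :=
  hochschildCocycles K A n ⧸ (hochschildCoboundaries K A n).submoduleOf (hochschildCocycles K A n)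

/-- `HH^*(A) = ⨁ n, HH^n(A)`. -/
abbrev TotalHochschildCohomology : Type _ := ⨁ n, HochschildCohomology K A n

variable {K A}

/-- The class of a cocycle in `HH^n(A)`, as an element of `HH^*(A)`. -/
def hochschildClass {n : ℕ} (f : HochschildCochain K A n) (hf : f ∈ hochschildCocycles K A n) :
    TotalHochschildCohomology K A :=
  DirectSum.of (HochschildCohomology K A) n (Submodule.Quotient.mk ⟨f, hf⟩)

/-- `B` is the bracket on `HH^*(A)` induced by the Gerstenhaber bracket of cochains. The bracket
of two classes of `HH^0(A)` lies in `HH^{-1}(A) = 0`. -/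
structure IsGerstenhaberBracket (B : TotalHochschildCohomology K A →ₗ[K]
    TotalHochschildCohomology K A →ₗ[K] TotalHochschildCohomology K A) : Prop where
  zero_zero : ∀ (f g : HochschildCochain K A 0) (hf : f ∈ hochschildCocycles K A 0)
    (hg : g ∈ hochschildCocycles K A 0), B (hochschildClass f hf) (hochschildClass g hg) = 0
  bracket_class : ∀ {n m N : ℕ} (h : N + 1 = n + m)
    (f : HochschildCochain K A n) (g : HochschildCochain K A m)
    (hf : f ∈ hochschildCocycles K A n) (hg : g ∈ hochschildCocycles K A m),
    ∃ hfg : f.bracket h g ∈ hochschildCocycles K A N,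
      B (hochschildClass f hf) (hochschildClass g hg) = hochschildClass (f.bracket h g) hfg

end Hochschild

/-! ### The bracket on `H^*(G, K) ⊗ KG` -/

section GroupSide

variable {K G : Type u} [Field K] [CommGroup G] {n m N : ℕ}

/-- `γ_i(x_0 | … | x_{N-1}) =`
`α(x_0 | … | x_i x_{i+1} ⋯ x_{i+m-1} y | … | x_{N-1}) β(x_i | … | x_{i+m-1})`. -/
def gammaAt (h : N + 1 = n + m) (α : (Fin n → G) → K) (β : (Fin m → G) → K) (y : G) (i : Fin n) :
    (Fin N → G) → K :=
  fun x => α (substAt h i x ((∏ k, blockAt h i x k) * y)) * β (blockAt h i x)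

/-- `γ_α^{(β,y)} = ∑_i (-1)^{(m-1) i} γ_i`, with `i` running over `0, …, n-1`. -/
def gammaSum (h : N + 1 = n + m) (α : (Fin n → G) → K) (β : (Fin m → G) → K) (y : G) :
    (Fin N → G) → K :=
  ∑ i : Fin n, (((m : ℤ) - 1) * (i : ℤ)).negOnePow • gammaAt h α β y i

/-- The coefficient `γ_α^{(β,y)} - (-1)^{(n-1)(m-1)} γ_β^{(α,x)}` of `xy` in
`[α ⊗ x, β ⊗ y]`. -/
def bracketCoeff (h : N + 1 = n + m) (α : (Fin n → G) → K) (x : G) (β : (Fin m → G) → K) (y : G) :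
    (Fin N → G) → K :=
  gammaSum h α β y
    - (((n : ℤ) - 1) * ((m : ℤ) - 1)).negOnePow • gammaSum (h.trans (add_comm n m)) β α x

/-- `α : G^n → K` is a cocycle for group cohomology with trivial coefficients. -/
def IsGroupCocycle (α : (Fin n → G) → K) : Prop :=
  inhomogeneousCochains.d (Rep.trivial K G K) n α = 0

variable (K G) in
/-- `H^n(G, K) ⊗ KG`. -/
abbrev GroupCohomologyTensor (n : ℕ) : Type u :=
  groupCohomology (Rep.trivial K G K) n ⊗[K] MonoidAlgebra K G

variable (K G) in
/-- `H^*(G, K) ⊗ KG = ⨁ n, H^n(G, K) ⊗ KG`. -/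
abbrev TotalGroupCohomologyTensor : Type u := ⨁ n, GroupCohomologyTensor K G n

/-- The element `[α] ⊗ x` for a cocycle `α : G^n → K` and `x ∈ G`. -/
noncomputable def tensorClass (α : (Fin n → G) → K) (hα : IsGroupCocycle α) (x : G) :
    TotalGroupCohomologyTensor K G :=
  DirectSum.of (GroupCohomologyTensor K G) n
    ((groupCohomology.π (Rep.trivial K G K) n (groupCohomology.cocyclesMk α hα) :
      groupCohomology (Rep.trivial K G K) n) ⊗ₜ[K] MonoidAlgebra.single x (1 : K))

/-- `B` is the bracket on `H^*(G, K) ⊗ KG` induced by the bracket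
`[α ⊗ x, β ⊗ y] = (γ_α^{(β,y)} - (-1)^{(n-1)(m-1)} γ_β^{(α,x)}) ⊗ xy` of cochains. The bracket of
two elements of `H^0(G, K) ⊗ KG` lies in `H^{-1}(G, K) ⊗ KG = 0`. -/
structure IsTransferredBracket (B : TotalGroupCohomologyTensor K G →ₗ[K]
    TotalGroupCohomologyTensor K G →ₗ[K] TotalGroupCohomologyTensor K G) : Prop where
  zero_zero : ∀ (α β : (Fin 0 → G) → K) (hα : IsGroupCocycle α) (hβ : IsGroupCocycle β)
    (x y : G), B (tensorClass α hα x) (tensorClass β hβ y) = 0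
  bracket_class : ∀ {n m N : ℕ} (h : N + 1 = n + m)
    (α : (Fin n → G) → K) (β : (Fin m → G) → K)
    (hα : IsGroupCocycle α) (hβ : IsGroupCocycle β) (x y : G),
    ∃ hαβ : IsGroupCocycle (bracketCoeff h α x β y),
      B (tensorClass α hα x) (tensorClass β hβ y) =
        tensorClass (bracketCoeff h α x β y) hαβ (x * y)

end GroupSide

/-!
The composition `f ∘ g` makes the Hochschild cochains of any algebra a graded right pre-Lie
algebra: in `(f ∘ g) ∘ k` the terms with `k` inserted into `g` sum to `f ∘ (g ∘ k)`, and the terms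
with `g` and `k` inserted side by side into `f` are graded symmetric in `g` and `k`. The graded
commutator of a graded pre-Lie product is a graded Lie bracket in every characteristic: for `|a|`
odd, `[a, [a, a]] = 0` is the associator symmetry of `a, a, a`. The Hochschild differential is
`δ f = -[f, μ]` with `μ` the multiplication, so the Jacobi identity shows that brackets of cocycles
are cocycles and that the bracket of a cocycle with a coboundary is a coboundary. Hence the
cohomology is a subquotient of the graded Lie algebra of cochains.

For `A = KG` with `G` finite abelian, a cochain `f` is determined by its components
`α_y : G^n → K`, where `f(x_1, …, x_n) = ∑ y, α_y(x_1, …, x_n) x_1 ⋯ x_n y`. The differential acts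
on each component as the differential of group cohomology, and the bracket of the monomial
cochains attached to `α ⊗ x` and `β ⊗ y` is the monomial cochain attached to `[α ⊗ x, β ⊗ y]`. So
taking components identifies `HH^*(KG)` with `H^*(G, K) ⊗ KG` and carries the Gerstenhaber bracket
to the bracket of the theorem.
-/

/-! ### The shifted grading -/

section ShiftedGrading

variable {K : Type*} [Field K] {M : ℕ → Type*} [∀ n, AddCommGroup (M n)] [∀ n, Module K (M n)]

theorem of_mem_shiftedGrading {n : ℕ} {k : ℤ} (hk : (n : ℤ) - 1 = k) (a : M n) :
    DirectSum.of M n a ∈ shiftedGrading K M k :=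
  fun _ hn => DirectSum.of_eq_of_ne _ _ _ fun h => hn (h ▸ hk)

theorem eq_zero_or_exists_of_mem_shiftedGrading {k : ℤ} {x : ⨁ n, M n}
    (hx : x ∈ shiftedGrading K M k) :
    x = 0 ∨ ∃ (n : ℕ) (a : M n), (n : ℤ) - 1 = k ∧ DirectSum.of M n a = x := by
  by_cases h : ∃ n : ℕ, (n : ℤ) - 1 = k
  · obtain ⟨n, rfl⟩ := h
    refine .inr ⟨n, x n, rfl, DFinsupp.ext fun l => ?_⟩
    obtain rfl | hl := eq_or_ne l n
    · exact DirectSum.of_eq_same l _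
    · exact (DirectSum.of_eq_of_ne _ _ _ hl).trans (hx l (by omega)).symm
  · exact .inl (DFinsupp.ext fun n => hx n fun hn => h ⟨n, hn⟩)

variable (K M) in
theorem isInternal_shiftedGrading : DirectSum.IsInternal (shiftedGrading K M) := by
  let homogeneous (n : ℕ) : M n →ₗ[K] shiftedGrading K M ((n : ℤ) - 1) :=
    (DirectSum.lof K ℕ M n).codRestrict _ (of_mem_shiftedGrading rfl)
  let decompose : (⨁ n, M n) →ₗ[K] ⨁ k, shiftedGrading K M k :=
    DirectSum.toModule K ℕ _ fun n => DirectSum.lof K ℤ _ ((n : ℤ) - 1) ∘ₗ homogeneous n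
  have decompose_of (n : ℕ) (a : M n) : decompose (DirectSum.of M n a) =
      DirectSum.lof K ℤ _ ((n : ℤ) - 1) (homogeneous n a) :=
    DirectSum.toModule_lof K n a
  suffices DirectSum.Decomposition (shiftedGrading K M) from DirectSum.Decomposition.isInternal _
  refine .ofLinearMap _ decompose ?_ ?_
  · ext n a : 2
    simp only [LinearMap.comp_apply, DirectSum.lof_eq_of K ℕ, decompose_of,
      DirectSum.coeLinearMap_lof]
    rfl
  · ext k ⟨x, hx⟩ : 2
    simp only [LinearMap.comp_apply, DirectSum.coeLinearMap_lof, LinearMap.id_apply]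
    obtain rfl | ⟨n, a, rfl, rfl⟩ := eq_zero_or_exists_of_mem_shiftedGrading hx
    · exact (map_zero decompose).trans (map_zero (DirectSum.lof K ℤ _ k)).symm
    · exact decompose_of n a

/-- The bilinear map of degree `0` on the shifted grading `M^{*+1}` with components
`c : M n × M m → M (n + m - 1)`. The component with `n = m = 0` is zero. -/
noncomputable def shiftedBilinear
    (c : ∀ n m N : ℕ, N + 1 = n + m → M n →ₗ[K] M m →ₗ[K] M N) :
    (⨁ n, M n) →ₗ[K] (⨁ n, M n) →ₗ[K] ⨁ n, M n :=
  DirectSum.toModule K ℕ _ fun n => .flip <| DirectSum.toModule K ℕ _ fun m => .flip <|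
    if h : n + m - 1 + 1 = n + m then
      (c n m (n + m - 1) h).compr₂ (DirectSum.lof K ℕ M (n + m - 1))
    else 0

variable {c : ∀ n m N : ℕ, N + 1 = n + m → M n →ₗ[K] M m →ₗ[K] M N}

theorem shiftedBilinear_of_of {n m N : ℕ} (h : N + 1 = n + m) (a : M n) (b : M m) :
    shiftedBilinear c (DirectSum.of M n a) (DirectSum.of M m b) =
      DirectSum.of M N (c n m N h a b) := by
  obtain rfl : N = n + m - 1 := by omega
  simp only [shiftedBilinear, ← DirectSum.lof_eq_of K ℕ M, DirectSum.toModule_lof,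
    LinearMap.flip_apply, dif_pos h, LinearMap.compr₂_apply]

theorem shiftedBilinear_of_zero_of_zero (a b : M 0) :
    shiftedBilinear c (DirectSum.of M 0 a) (DirectSum.of M 0 b) = 0 := by
  simp only [shiftedBilinear, ← DirectSum.lof_eq_of K ℕ M, DirectSum.toModule_lof,
    LinearMap.flip_apply]
  rfl

theorem eq_zero_and_eq_zero_or_exists_add_one_eq_add (n m : ℕ) :
    (n = 0 ∧ m = 0) ∨ ∃ N, N + 1 = n + m := by
  rcases h : n + m with _ | N
  · exact .inl (by omega)
  · exact .inr ⟨N, rfl⟩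

theorem shiftedBilinear_mem {i j : ℤ} {x y : ⨁ n, M n} (hx : x ∈ shiftedGrading K M i)
    (hy : y ∈ shiftedGrading K M j) : shiftedBilinear c x y ∈ shiftedGrading K M (i + j) := by
  obtain rfl | ⟨n, a, rfl, rfl⟩ := eq_zero_or_exists_of_mem_shiftedGrading hx
  · simp
  obtain rfl | ⟨m, b, rfl, rfl⟩ := eq_zero_or_exists_of_mem_shiftedGrading hy
  · simp
  obtain ⟨rfl, rfl⟩ | ⟨N, h⟩ := eq_zero_and_eq_zero_or_exists_add_one_eq_add n m
  · simp [shiftedBilinear_of_zero_of_zero]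
  · rw [shiftedBilinear_of_of h]
    exact of_mem_shiftedGrading (by omega) _

section Lmap

variable {M' : ℕ → Type*} [∀ n, AddCommGroup (M' n)] [∀ n, Module K (M' n)]
  {φ : ∀ n, M n →ₗ[K] M' n}

theorem lmap_mem_shiftedGrading (φ : ∀ n, M n →ₗ[K] M' n) {k : ℤ} {x : ⨁ n, M n}
    (hx : x ∈ shiftedGrading K M k) : DirectSum.lmap φ x ∈ shiftedGrading K M' k := by
  intro n hn
  rw [DirectSum.lmap_apply, hx n hn, map_zero]

theorem mem_shiftedGrading_iff_exists_lmap_eq (hφ : ∀ n, Function.Surjective (φ n)) {k : ℤ}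
    {y : ⨁ n, M' n} :
    y ∈ shiftedGrading K M' k ↔ ∃ x ∈ shiftedGrading K M k, DirectSum.lmap φ x = y := by
  refine ⟨fun hy => ?_, fun ⟨x, hx, hxy⟩ => hxy ▸ lmap_mem_shiftedGrading φ hx⟩
  obtain rfl | ⟨n, a, rfl, rfl⟩ := eq_zero_or_exists_of_mem_shiftedGrading hy
  · exact ⟨0, zero_mem _, map_zero _⟩
  · obtain ⟨a, rfl⟩ := hφ n a
    exact ⟨_, of_mem_shiftedGrading rfl a, DirectSum.lmap_of φ n a⟩

end Lmap

end ShiftedGrading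

/-! ### Graded pre-Lie algebras -/

section GradedPreLie

variable {K L : Type*} [CommRing K] [AddCommGroup L] [Module K L]

/-- `circ` is a graded right pre-Lie product for the grading `𝓛`: it has degree zero and its
associator is graded symmetric in the last two variables. -/
structure IsGradedPreLie (𝓛 : ℤ → Submodule K L) (circ : L →ₗ[K] L →ₗ[K] L) : Prop where
  circ_mem : ∀ {i j : ℤ} {x y : L}, x ∈ 𝓛 i → y ∈ 𝓛 j → circ x y ∈ 𝓛 (i + j)
  associator_symm : ∀ {i j k : ℤ} {x y z : L}, x ∈ 𝓛 i → y ∈ 𝓛 j → z ∈ 𝓛 k →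
    circ (circ x y) z - circ x (circ y z) =
      (j * k).negOnePow • (circ (circ x z) y - circ x (circ z y))

/-- `br` is the graded commutator of `circ` for the grading `𝓛`. -/
def IsGradedCommutator (𝓛 : ℤ → Submodule K L) (circ br : L →ₗ[K] L →ₗ[K] L) : Prop :=
  ∀ {i j : ℤ} {x y : L}, x ∈ 𝓛 i → y ∈ 𝓛 j → br x y = circ x y - (i * j).negOnePow • circ y x

namespace IsGradedCommutator

variable {𝓛 : ℤ → Submodule K L} {circ br : L →ₗ[K] L →ₗ[K] L} {i j k : ℤ} {x y z : L}

theorem bracket_mem (hbr : IsGradedCommutator 𝓛 circ br) (hcirc : IsGradedPreLie 𝓛 circ)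
    (hx : x ∈ 𝓛 i) (hy : y ∈ 𝓛 j) : br x y ∈ 𝓛 (i + j) := by
  rw [hbr hx hy]
  exact sub_mem (hcirc.circ_mem hx hy)
    (Submodule.smul_of_tower_mem _ _ (add_comm j i ▸ hcirc.circ_mem hy hx))

theorem antisymm (hbr : IsGradedCommutator 𝓛 circ br) (hx : x ∈ 𝓛 i) (hy : y ∈ 𝓛 j) :
    br x y = -((i * j).negOnePow • br y x) := by
  rw [hbr hx hy, hbr hy hx, mul_comm j i, smul_sub, smul_smul, Int.units_mul_self, one_smul,
    neg_sub]

theorem bracket_self (hbr : IsGradedCommutator 𝓛 circ br) (hi : Even i) (hx : x ∈ 𝓛 i) :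
    br x x = 0 := by
  rw [hbr hx hx, Int.negOnePow_even _ (hi.mul_left i), one_smul, sub_self]

-- The Jacobi identity is a signed sum of the associator symmetries of the three cyclic
-- permutations of `x, y, z`.
theorem jacobi (hbr : IsGradedCommutator 𝓛 circ br) (hcirc : IsGradedPreLie 𝓛 circ)
    (hx : x ∈ 𝓛 i) (hy : y ∈ 𝓛 j) (hz : z ∈ 𝓛 k) :
    br x (br y z) = br (br x y) z + (i * j).negOnePow • br y (br x z) := by
  have hxyz := hcirc.associator_symm hx hy hz
  have hyzx := congrArg ((i * j).negOnePow • (i * k).negOnePow • ·)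
    (hcirc.associator_symm hy hz hx)
  have hzxy := congrArg ((i * k).negOnePow • (j * k).negOnePow • ·)
    (hcirc.associator_symm hz hx hy)
  rw [hbr hx (hbr.bracket_mem hcirc hy hz), hbr (hbr.bracket_mem hcirc hx hy) hz,
    hbr hy (hbr.bracket_mem hcirc hx hz), hbr hx hy, hbr hy hz, hbr hx hz]
  simp only [mul_add, add_mul, Int.negOnePow_add, mul_comm k i, mul_comm j i] at hyzx ⊢
  generalize (i * j).negOnePow = a at *
  generalize (i * k).negOnePow = b at *
  generalize (j * k).negOnePow = c at *
  obtain rfl | rfl := Int.units_eq_one_or a <;> obtain rfl | rfl := Int.units_eq_one_or b <;>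
    obtain rfl | rfl := Int.units_eq_one_or c <;>
  · simp only [one_smul, Units.neg_smul, map_sub, map_neg, LinearMap.sub_apply,
      LinearMap.neg_apply, mul_one, mul_neg, neg_neg] at hxyz hyzx hzxy ⊢
    linear_combination (norm := module) -hxyz - hyzx - hzxy

theorem bracket_bracket_self (hbr : IsGradedCommutator 𝓛 circ br)
    (hcirc : IsGradedPreLie 𝓛 circ) (hi : Odd i) (hx : x ∈ 𝓛 i) : br x (br x x) = 0 := by
  have hxxx := hcirc.associator_symm hx hx hx
  rw [hbr hx (hbr.bracket_mem hcirc hx hx), hbr hx hx,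
    Int.negOnePow_even (i * (i + i)) ((Even.add_self i).mul_left i)]
  simp only [Int.negOnePow_odd _ (hi.mul hi), one_smul, Units.neg_smul, map_sub, map_neg,
    LinearMap.sub_apply, LinearMap.neg_apply] at hxxx ⊢
  linear_combination (norm := module) -hxxx

end IsGradedCommutator

theorem IsGradedPreLie.isGradedLieAlgebra {K L : Type*} [Field K] [AddCommGroup L] [Module K L]
    {𝓛 : ℤ → Submodule K L} {circ br : L →ₗ[K] L →ₗ[K] L} (hcirc : IsGradedPreLie 𝓛 circ)
    (hbr : IsGradedCommutator 𝓛 circ br) (h𝓛 : DirectSum.IsInternal 𝓛) :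
    IsGradedLieAlgebra 𝓛 br where
  isInternal := h𝓛
  bracket_mem := hbr.bracket_mem hcirc
  antisymm := hbr.antisymm
  jacobi := hbr.jacobi hcirc
  bracket_self := hbr.bracket_self
  bracket_bracket_self := hbr.bracket_bracket_self hcirc

end GradedPreLie

/-! ### Subquotients of graded Lie algebras -/

section GradedLie

variable {K L H : Type*} [Field K] [AddCommGroup L] [Module K L] [AddCommGroup H] [Module K H]
  {𝓛 : ℤ → Submodule K L} {B : L →ₗ[K] L →ₗ[K] L}
  {𝓗 : ℤ → Submodule K H} {B' : H →ₗ[K] H →ₗ[K] H}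

namespace IsGradedLieAlgebra

theorem bracket_bracket (hL : IsGradedLieAlgebra 𝓛 B) {i j k : ℤ} {x y z : L} (hx : x ∈ 𝓛 i)
    (hy : y ∈ 𝓛 j) (hz : z ∈ 𝓛 k) :
    B (B x y) z = B x (B y z) + (j * k).negOnePow • B (B x z) y := by
  rw [hL.jacobi hx hy hz, hL.antisymm hy (hL.bracket_mem hx hz), smul_neg, smul_smul, mul_add,
    Int.negOnePow_add, mul_comm j i, ← mul_assoc, Int.units_mul_self, one_mul,
    neg_add_cancel_right]

theorem of_subquotient {Z : Type*} [AddCommGroup Z] [Module K Z] {𝓩 : ℤ → Submodule K Z}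
    (hL : IsGradedLieAlgebra 𝓛 B) (h𝓗 : DirectSum.IsInternal 𝓗)
    {ι : Z →ₗ[K] L} (hι : Function.Injective ι) (hι_mem : ∀ {i z}, z ∈ 𝓩 i → ι z ∈ 𝓛 i)
    {q : Z →ₗ[K] H} (hq : ∀ {i x}, x ∈ 𝓗 i ↔ ∃ z ∈ 𝓩 i, q z = x)
    (hB : ∀ {i j x y}, x ∈ 𝓩 i → y ∈ 𝓩 j →
      ∃ z ∈ 𝓩 (i + j), ι z = B (ι x) (ι y) ∧ q z = B' (q x) (q y)) :
    IsGradedLieAlgebra 𝓗 B' where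
  isInternal := h𝓗
  bracket_mem hqx hqy := by
    obtain ⟨x, hx, rfl⟩ := hq.1 hqx
    obtain ⟨y, hy, rfl⟩ := hq.1 hqy
    obtain ⟨xy, hxy, -, hqxy⟩ := hB hx hy
    exact hq.2 ⟨xy, hxy, hqxy⟩
  antisymm {i j _ _} hqx hqy := by
    obtain ⟨x, hx, rfl⟩ := hq.1 hqx
    obtain ⟨y, hy, rfl⟩ := hq.1 hqy
    obtain ⟨xy, -, hιxy, hqxy⟩ := hB hx hy
    obtain ⟨yx, -, hιyx, hqyx⟩ := hB hy hx
    have : xy = -((i * j).negOnePow • yx) := hι <| by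
      rw [map_neg, LinearMap.map_smul_of_tower, hιxy, hιyx,
        hL.antisymm (hι_mem hx) (hι_mem hy)]
    rw [← hqxy, ← hqyx, this, map_neg, LinearMap.map_smul_of_tower]
  jacobi {i j _ _ _ _} hqx hqy hqz := by
    obtain ⟨x, hx, rfl⟩ := hq.1 hqx
    obtain ⟨y, hy, rfl⟩ := hq.1 hqy
    obtain ⟨z, hz, rfl⟩ := hq.1 hqz
    obtain ⟨xy, hxy, hιxy, hqxy⟩ := hB hx hy
    obtain ⟨xz, hxz, hιxz, hqxz⟩ := hB hx hz
    obtain ⟨yz, hyz, hιyz, hqyz⟩ := hB hy hz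
    obtain ⟨x_yz, -, hιx_yz, hqx_yz⟩ := hB hx hyz
    obtain ⟨xy_z, -, hιxy_z, hqxy_z⟩ := hB hxy hz
    obtain ⟨y_xz, -, hιy_xz, hqy_xz⟩ := hB hy hxz
    have : x_yz = xy_z + (i * j).negOnePow • y_xz := hι <| by
      rw [map_add, LinearMap.map_smul_of_tower, hιx_yz, hιxy_z, hιy_xz, hιxy, hιxz, hιyz,
        hL.jacobi (hι_mem hx) (hι_mem hy) (hι_mem hz)]
    rw [← hqyz, ← hqxy, ← hqxz, ← hqx_yz, ← hqxy_z, ← hqy_xz, this, map_add,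
      LinearMap.map_smul_of_tower]
  bracket_self hi hqx := by
    obtain ⟨x, hx, rfl⟩ := hq.1 hqx
    obtain ⟨xx, -, hιxx, hqxx⟩ := hB hx hx
    have : xx = 0 := hι <| by rw [map_zero, hιxx, hL.bracket_self hi (hι_mem hx)]
    rw [← hqxx, this, map_zero]
  bracket_bracket_self hi hqx := by
    obtain ⟨x, hx, rfl⟩ := hq.1 hqx
    obtain ⟨xx, hxx, hιxx, hqxx⟩ := hB hx hx
    obtain ⟨x_xx, -, hιx_xx, hqx_xx⟩ := hB hx hxx
    have : x_xx = 0 := hι <| by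
      rw [map_zero, hιx_xx, hιxx, hL.bracket_bracket_self hi (hι_mem hx)]
    rw [← hqxx, ← hqx_xx, this, map_zero]

end IsGradedLieAlgebra

theorem IsGradedLieIso.isGradedLieAlgebra {e : L ≃ₗ[K] H} (he : IsGradedLieIso 𝓛 B 𝓗 B' e)
    (hL : IsGradedLieAlgebra 𝓛 B) (h𝓗 : DirectSum.IsInternal 𝓗) : IsGradedLieAlgebra 𝓗 B' :=
  hL.of_subquotient h𝓗 (ι := LinearMap.id) Function.injective_id (fun hz => hz)
    (q := e.toLinearMap)
    (fun {i x} => ⟨fun hx => ⟨e.symm x, (he.mem_iff i _).1 (by simpa using hx), by simp⟩,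
      fun ⟨z, hz, hzx⟩ => hzx ▸ (he.mem_iff i z).2 hz⟩)
    (fun hx hy => ⟨_, hL.bracket_mem hx hy, rfl, he.map_bracket _ _⟩)

end GradedLie

/-! ### Iterated substitution of blocks -/

section IteratedSubstitution

variable {X : Type*} {n m l N N' Q P : ℕ}

theorem blockAt_blockAt (h₂ : P + 1 = N + l) (h₃ : Q + 1 = m + l) (h₄ : P + 1 = n + Q)
    (x : Fin P → X) {i : Fin n} {r : Fin m} {j : Fin N} (hj : (j : ℕ) = i + r) :
    blockAt h₃ r (blockAt h₄ i x) = blockAt h₂ j x := by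
  funext t
  simp only [blockAt]
  congr 2
  omega

theorem blockAt_substAt_inside (h₁ : N + 1 = n + m) (h₂ : P + 1 = N + l) (h₃ : Q + 1 = m + l)
    (h₄ : P + 1 = n + Q) (x : Fin P → X) {i : Fin n} {r : Fin m} {j : Fin N}
    (hj : (j : ℕ) = i + r) (a : X) :
    blockAt h₁ i (substAt h₂ j x a) = substAt h₃ r (blockAt h₄ i x) a := by
  funext t
  simp only [blockAt, substAt]
  split_ifs <;> first | rfl | omega | (congr 2; omega)

theorem substAt_substAt_inside (h₁ : N + 1 = n + m) (h₂ : P + 1 = N + l) (h₄ : P + 1 = n + Q)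
    (x : Fin P → X) {i : Fin n} (r : Fin m) {j : Fin N} (hj : (j : ℕ) = i + r) (a b : X) :
    substAt h₁ i (substAt h₂ j x a) b = substAt h₄ i x b := by
  funext t
  simp only [substAt]
  split_ifs <;> first | rfl | omega | (congr 2; omega)

theorem blockAt_substAt_of_lt (h₁ : N + 1 = n + m) (h₂ : P + 1 = N + l) (h₄ : P + 1 = N' + m)
    (x : Fin P → X) {i : Fin n} {j : Fin N} {i' : Fin N'} (hij : (j : ℕ) < i)
    (hi' : (i' : ℕ) + 1 = i + l) (a : X) :
    blockAt h₁ i (substAt h₂ j x a) = blockAt h₄ i' x := by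
  funext t
  simp only [blockAt, substAt]
  split_ifs <;> first | rfl | omega | (congr 2; omega)

theorem blockAt_substAt_of_gt (h₁ : N + 1 = n + m) (h₂ : P + 1 = N + l) (h₄ : P + 1 = N' + m)
    (x : Fin P → X) {i : Fin N'} {j : Fin N} {i' : Fin n} (hi : (i : ℕ) = i')
    (hij : (i : ℕ) + m ≤ j) (a : X) :
    blockAt h₁ i' (substAt h₂ j x a) = blockAt h₄ i x := by
  funext t
  have ht := t.2
  simp only [blockAt, substAt]
  split_ifs <;> first | rfl | omega | (congr 2; omega)

theorem substAt_substAt_comm (h₁ : N + 1 = n + m) (h₂ : P + 1 = N + l) (h₃ : N' + 1 = n + l)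
    (h₄ : P + 1 = N' + m) (x : Fin P → X) {i j' : Fin n} {j : Fin N} {i' : Fin N'}
    (hj : (j : ℕ) = j') (hij : (j : ℕ) < i) (hi' : (i' : ℕ) + 1 = i + l) (a b : X) :
    substAt h₁ i (substAt h₂ j x a) b = substAt h₃ j' (substAt h₄ i' x b) a := by
  funext t
  simp only [substAt]
  split_ifs <;> first | rfl | omega | (congr 2; omega)

end IteratedSubstitution

/-! ### The pre-Lie identity for Hochschild cochains -/

section PreLieIdentity

variable {K : Type*} [Field K] {A : Type*} [Ring A] [Algebra K A] {n m l N N' Q P : ℕ}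

namespace HochschildCochain

theorem compAt_compAt_inside (h₁ : N + 1 = n + m) (h₂ : P + 1 = N + l) (h₃ : Q + 1 = m + l)
    (h₄ : P + 1 = n + Q) (f : HochschildCochain K A n) (g : HochschildCochain K A m)
    (k : HochschildCochain K A l) {i : Fin n} {r : Fin m} {j : Fin N} (hj : (j : ℕ) = i + r) :
    (f.compAt h₁ i g).compAt h₂ j k = f.compAt h₄ i (g.compAt h₃ r k) := by
  ext x
  simp only [compAt_apply]
  rw [blockAt_substAt_inside h₁ h₂ h₃ h₄ x hj, substAt_substAt_inside h₁ h₂ h₄ x r hj,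
    blockAt_blockAt h₂ h₃ h₄ x hj]

theorem compAt_compAt_comm (h₁ : N + 1 = n + m) (h₂ : P + 1 = N + l) (h₃ : N' + 1 = n + l)
    (h₄ : P + 1 = N' + m) (f : HochschildCochain K A n) (g : HochschildCochain K A m)
    (k : HochschildCochain K A l) {i j' : Fin n} {j : Fin N} {i' : Fin N'}
    (hj : (j : ℕ) = j') (hij : (j : ℕ) < i) (hi' : (i' : ℕ) + 1 = i + l) :
    (f.compAt h₁ i g).compAt h₂ j k = (f.compAt h₃ j' k).compAt h₄ i' g := by
  ext x
  simp only [compAt_apply]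
  rw [blockAt_substAt_of_lt h₁ h₂ h₄ x hij hi', blockAt_substAt_of_gt h₃ h₄ h₂ x hj (by omega),
    substAt_substAt_comm h₁ h₂ h₃ h₄ x hj hij hi']

variable (K A) in
/-- The partial composition `f ∘_i g` as a bilinear map. -/
def compAtₗ (h : N + 1 = n + m) (i : Fin n) :
    HochschildCochain K A n →ₗ[K] HochschildCochain K A m →ₗ[K] HochschildCochain K A N :=
  LinearMap.mk₂ K (fun f g => f.compAt h i g) (fun f f' g => compAt_add_left h f f' i g)
    (fun c f g => compAt_smul_left h c f i g) (fun f g g' => compAt_add_right h f i g g')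
    (fun c f g => compAt_smul_right h c f i g)

theorem compAtₗ_apply (h : N + 1 = n + m) (i : Fin n) (f : HochschildCochain K A n)
    (g : HochschildCochain K A m) : compAtₗ K A h i f g = f.compAt h i g := rfl

variable (K A) in
/-- The composition `f ∘ g` as a bilinear map. -/
def compₗ (h : N + 1 = n + m) :
    HochschildCochain K A n →ₗ[K] HochschildCochain K A m →ₗ[K] HochschildCochain K A N :=
  ∑ i : Fin n, ((i : ℤ) * ((m : ℤ) - 1)).negOnePow • compAtₗ K A h i

theorem compₗ_apply (h : N + 1 = n + m) (f : HochschildCochain K A n)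
    (g : HochschildCochain K A m) : compₗ K A h f g = f.comp h g := by
  simp only [compₗ, comp, LinearMap.sum_apply, LinearMap.smul_apply, compAtₗ_apply]

/-- The term of `(f ∘ g) ∘ k` in which `g` is inserted at position `p.1` and then `k` at
position `p.2`. -/
def compTerm (h₁ : N + 1 = n + m) (h₂ : P + 1 = N + l) (f : HochschildCochain K A n)
    (g : HochschildCochain K A m) (k : HochschildCochain K A l) (p : Fin n × Fin N) :
    HochschildCochain K A P :=
  ((p.1 : ℤ) * ((m : ℤ) - 1) + (p.2 : ℤ) * ((l : ℤ) - 1)).negOnePow •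
    (f.compAt h₁ p.1 g).compAt h₂ p.2 k

theorem comp_comp_eq_sum_compTerm (h₁ : N + 1 = n + m) (h₂ : P + 1 = N + l)
    (f : HochschildCochain K A n) (g : HochschildCochain K A m) (k : HochschildCochain K A l) :
    (f.comp h₁ g).comp h₂ k = ∑ p, compTerm h₁ h₂ f g k p := by
  simp only [comp, compTerm, Fintype.sum_prod_type_right, ← compAtₗ_apply, map_sum,
    LinearMap.sum_apply, LinearMap.map_smul_of_tower, LinearMap.smul_apply, Finset.smul_sum,
    smul_smul, ← Int.negOnePow_add, add_comm]

theorem comp_comp_right_eq_sum (h₃ : Q + 1 = m + l) (h₄ : P + 1 = n + Q)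
    (f : HochschildCochain K A n) (g : HochschildCochain K A m) (k : HochschildCochain K A l) :
    f.comp h₄ (g.comp h₃ k) = ∑ p : Fin n × Fin m,
      ((p.1 : ℤ) * ((Q : ℤ) - 1) + (p.2 : ℤ) * ((l : ℤ) - 1)).negOnePow •
        f.compAt h₄ p.1 (g.compAt h₃ p.2 k) := by
  simp only [comp, Fintype.sum_prod_type, ← compAtₗ_apply, map_sum, LinearMap.map_smul_of_tower,
    Finset.smul_sum, smul_smul, ← Int.negOnePow_add]

/-- The part of `(f ∘ g) ∘ k` in which `k` is inserted to the left of `g`. -/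
def leftTerms (h₁ : N + 1 = n + m) (h₂ : P + 1 = N + l) (f : HochschildCochain K A n)
    (g : HochschildCochain K A m) (k : HochschildCochain K A l) : HochschildCochain K A P :=
  ∑ p : Fin n × Fin N with (p.2 : ℕ) < p.1, compTerm h₁ h₂ f g k p

/-- The part of `(f ∘ g) ∘ k` in which `k` is inserted into `g`. -/
def insideTerms (h₁ : N + 1 = n + m) (h₂ : P + 1 = N + l) (f : HochschildCochain K A n)
    (g : HochschildCochain K A m) (k : HochschildCochain K A l) : HochschildCochain K A P :=
  ∑ p : Fin n × Fin N with (p.1 : ℕ) ≤ p.2 ∧ (p.2 : ℕ) < p.1 + m, compTerm h₁ h₂ f g k p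

/-- The part of `(f ∘ g) ∘ k` in which `k` is inserted to the right of `g`. -/
def rightTerms (h₁ : N + 1 = n + m) (h₂ : P + 1 = N + l) (f : HochschildCochain K A n)
    (g : HochschildCochain K A m) (k : HochschildCochain K A l) : HochschildCochain K A P :=
  ∑ p : Fin n × Fin N with (p.1 : ℕ) + m ≤ p.2, compTerm h₁ h₂ f g k p

theorem comp_comp_eq_add (h₁ : N + 1 = n + m) (h₂ : P + 1 = N + l)
    (f : HochschildCochain K A n) (g : HochschildCochain K A m) (k : HochschildCochain K A l) :
    (f.comp h₁ g).comp h₂ k =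
      leftTerms h₁ h₂ f g k + insideTerms h₁ h₂ f g k + rightTerms h₁ h₂ f g k := by
  rw [comp_comp_eq_sum_compTerm, leftTerms, insideTerms, rightTerms, Finset.sum_filter,
    Finset.sum_filter, Finset.sum_filter, ← Finset.sum_add_distrib, ← Finset.sum_add_distrib]
  refine Finset.sum_congr rfl fun p _ => ?_
  split_ifs <;> first | omega | simp

theorem leftTerms_eq_smul_rightTerms (h₁ : N + 1 = n + m) (h₂ : P + 1 = N + l)
    (h₃ : N' + 1 = n + l) (h₄ : P + 1 = N' + m) (f : HochschildCochain K A n)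
    (g : HochschildCochain K A m) (k : HochschildCochain K A l) :
    leftTerms h₁ h₂ f g k =
      (((m : ℤ) - 1) * ((l : ℤ) - 1)).negOnePow • rightTerms h₃ h₄ f k g := by
  rw [leftTerms, rightTerms, Finset.smul_sum]
  refine Finset.sum_bij'
    (fun p hp => (⟨p.2, by have := (Finset.mem_filter.1 hp).2; omega⟩,
      ⟨p.1 + l - 1, by have := (Finset.mem_filter.1 hp).2; omega⟩))
    (fun p hp => (⟨p.2 + 1 - l, by have := (Finset.mem_filter.1 hp).2; omega⟩,
      ⟨p.1, by have := (Finset.mem_filter.1 hp).2; omega⟩)) ?_ ?_ ?_ ?_ ?_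
  all_goals
    rintro ⟨i, j⟩ hp
    replace hp := (Finset.mem_filter.1 hp).2
    dsimp only at hp
  · exact Finset.mem_filter.2 ⟨Finset.mem_univ _, by dsimp only; omega⟩
  · exact Finset.mem_filter.2 ⟨Finset.mem_univ _, by dsimp only; omega⟩
  · ext <;> dsimp only
    omega
  · ext <;> dsimp only
    omega
  · have hi' : ((i + l - 1 : ℕ) : ℤ) = i + l - 1 := by omega
    rw [compTerm, compTerm, smul_smul, ← Int.negOnePow_add, hi',
      compAt_compAt_comm h₁ h₂ h₃ h₄ (j' := ⟨j, by omega⟩) (i' := ⟨i + l - 1, by omega⟩)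
        f g k rfl hp (by dsimp only; omega)]
    congr 1
    exact (Int.negOnePow_eq_iff _ _).2 ⟨-(((m : ℤ) - 1) * ((l : ℤ) - 1)), by ring⟩

theorem comp_comp_sub_insideTerms (h₁ : N + 1 = n + m) (h₂ : P + 1 = N + l)
    (h₃ : N' + 1 = n + l) (h₄ : P + 1 = N' + m) (f : HochschildCochain K A n)
    (g : HochschildCochain K A m) (k : HochschildCochain K A l) :
    (f.comp h₁ g).comp h₂ k - insideTerms h₁ h₂ f g k =
      (((m : ℤ) - 1) * ((l : ℤ) - 1)).negOnePow •
        ((f.comp h₃ k).comp h₄ g - insideTerms h₃ h₄ f k g) := by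
  rw [comp_comp_eq_add, comp_comp_eq_add, leftTerms_eq_smul_rightTerms h₁ h₂ h₃ h₄ f g k,
    leftTerms_eq_smul_rightTerms h₃ h₄ h₁ h₂ f k g, mul_comm ((l : ℤ) - 1), add_right_comm,
    add_sub_cancel_right, add_right_comm, add_sub_cancel_right, smul_add, smul_smul,
    Int.units_mul_self, one_smul, add_comm]

theorem insideTerms_eq_comp_comp (h₁ : N + 1 = n + m) (h₂ : P + 1 = N + l) (h₃ : Q + 1 = m + l)
    (h₄ : P + 1 = n + Q) (f : HochschildCochain K A n) (g : HochschildCochain K A m)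
    (k : HochschildCochain K A l) :
    insideTerms h₁ h₂ f g k = f.comp h₄ (g.comp h₃ k) := by
  rw [comp_comp_right_eq_sum, insideTerms]
  refine Finset.sum_bij'
    (fun p hp => (p.1, ⟨p.2 - p.1, by have := (Finset.mem_filter.1 hp).2; omega⟩))
    (fun p _ => (p.1, ⟨p.1 + p.2, by omega⟩)) (fun _ _ => Finset.mem_univ _)
    (fun p _ => Finset.mem_filter.2 ⟨Finset.mem_univ _, by dsimp only; omega⟩) ?_ ?_ ?_
  · intro p hp
    have := (Finset.mem_filter.1 hp).2
    ext <;> dsimp only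
    omega
  · intro p _
    ext <;> dsimp only
    omega
  · rintro ⟨i, j⟩ hp
    have hij := (Finset.mem_filter.1 hp).2
    dsimp only at hij
    have hr : ((j - i : ℕ) : ℤ) = j - i := by omega
    have hQ : (Q : ℤ) = m + l - 1 := by omega
    rw [compTerm, hr, hQ,
      compAt_compAt_inside h₁ h₂ h₃ h₄ (r := ⟨j - i, by omega⟩) f g k (by dsimp only; omega)]
    congr 2
    ring

theorem insideTerms_of_zero (h₁ : N + 1 = n + 0) (h₂ : P + 1 = N + l)
    (f : HochschildCochain K A n) (g : HochschildCochain K A 0) (k : HochschildCochain K A l) :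
    insideTerms h₁ h₂ f g k = 0 := by
  rw [insideTerms, Finset.filter_false_of_mem fun p _ => by omega, Finset.sum_empty]

end HochschildCochain

end PreLieIdentity

/-! ### The graded Lie algebra of Hochschild cochains -/

section TotalCochains

variable {K : Type*} [Field K] {A : Type*} [Ring A] [Algebra K A] {n m l N P : ℕ}

namespace HochschildCochain

variable (K A) in
/-- The Gerstenhaber bracket of cochains as a bilinear map. -/
def bracketₗ (h : N + 1 = n + m) :
    HochschildCochain K A n →ₗ[K] HochschildCochain K A m →ₗ[K] HochschildCochain K A N :=
  compₗ K A h -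
    (((n : ℤ) - 1) * ((m : ℤ) - 1)).negOnePow • (compₗ K A (h.trans (add_comm n m))).flip

theorem bracketₗ_apply (h : N + 1 = n + m) (f : HochschildCochain K A n)
    (g : HochschildCochain K A m) : bracketₗ K A h f g = f.bracket h g := by
  simp only [bracketₗ, bracket, LinearMap.sub_apply, LinearMap.smul_apply, LinearMap.flip_apply,
    compₗ_apply]

variable (K A) in
/-- The composition product `f ∘ g` on `⨁ n, C^n(A)`. -/
noncomputable def totalComp : (⨁ n, HochschildCochain K A n) →ₗ[K]
    (⨁ n, HochschildCochain K A n) →ₗ[K] ⨁ n, HochschildCochain K A n :=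
  shiftedBilinear fun _ _ _ h => compₗ K A h

variable (K A) in
/-- The Gerstenhaber bracket on `⨁ n, C^n(A)`. -/
noncomputable def totalBracket : (⨁ n, HochschildCochain K A n) →ₗ[K]
    (⨁ n, HochschildCochain K A n) →ₗ[K] ⨁ n, HochschildCochain K A n :=
  shiftedBilinear fun _ _ _ h => bracketₗ K A h

theorem totalComp_of_of (h : N + 1 = n + m) (f : HochschildCochain K A n)
    (g : HochschildCochain K A m) :
    totalComp K A (DirectSum.of _ n f) (DirectSum.of _ m g) = DirectSum.of _ N (f.comp h g) :=
  (shiftedBilinear_of_of h f g).trans (congrArg _ (compₗ_apply h f g))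

theorem totalBracket_of_of (h : N + 1 = n + m) (f : HochschildCochain K A n)
    (g : HochschildCochain K A m) :
    totalBracket K A (DirectSum.of _ n f) (DirectSum.of _ m g) =
      DirectSum.of _ N (f.bracket h g) :=
  (shiftedBilinear_of_of h f g).trans (congrArg _ (bracketₗ_apply h f g))

theorem totalComp_of_zero (f : HochschildCochain K A 0) :
    totalComp K A (DirectSum.of _ 0 f) = 0 := by
  refine DirectSum.linearMap_ext K fun m => LinearMap.ext fun g => ?_
  obtain _ | m := m
  · exact shiftedBilinear_of_zero_of_zero f g
  · refine (totalComp_of_of (Nat.zero_add (m + 1)).symm f g).trans ?_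
    rw [comp, Finset.univ_eq_empty, Finset.sum_empty]
    exact map_zero _

theorem totalComp_of_totalComp (h₁ : N + 1 = n + m) (h₂ : P + 1 = N + l)
    (f : HochschildCochain K A n) (g : HochschildCochain K A m) (k : HochschildCochain K A l) :
    totalComp K A (DirectSum.of _ n f) (totalComp K A (DirectSum.of _ m g) (DirectSum.of _ l k)) =
      DirectSum.of _ P (insideTerms h₁ h₂ f g k) := by
  obtain ⟨rfl, rfl⟩ | ⟨Q, hQ⟩ := eq_zero_and_eq_zero_or_exists_add_one_eq_add m l
  · rw [totalComp_of_zero, insideTerms_of_zero, LinearMap.zero_apply, map_zero, map_zero]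
  · rw [totalComp_of_of hQ, totalComp_of_of (N := P) (by omega),
      insideTerms_eq_comp_comp h₁ h₂ hQ]

variable (K A)

theorem isGradedPreLie_totalComp :
    IsGradedPreLie (shiftedGrading K (HochschildCochain K A)) (totalComp K A) where
  circ_mem := shiftedBilinear_mem
  associator_symm := by
    intro i j k x y z hx hy hz
    obtain rfl | ⟨n, f, rfl, rfl⟩ := eq_zero_or_exists_of_mem_shiftedGrading hx
    · simp
    obtain rfl | ⟨m, g, rfl, rfl⟩ := eq_zero_or_exists_of_mem_shiftedGrading hy
    · simp
    obtain rfl | ⟨l, k, rfl, rfl⟩ := eq_zero_or_exists_of_mem_shiftedGrading hz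
    · simp
    obtain _ | n := n
    · simp only [totalComp_of_zero, map_zero, LinearMap.zero_apply, sub_zero,
        smul_zero]
    have hnm : n + m + 1 = n + 1 + m := by omega
    have hnl : n + l + 1 = n + 1 + l := by omega
    obtain ⟨hnm₀, rfl⟩ | ⟨P, hP⟩ := eq_zero_and_eq_zero_or_exists_add_one_eq_add (n + m) l
    · obtain ⟨rfl, rfl⟩ : n = 0 ∧ m = 0 := by omega
      simp [totalComp_of_of hnm, totalComp_of_zero]
    · have hP' : P + 1 = n + l + m := by omega
      rw [totalComp_of_totalComp hnm hP, totalComp_of_totalComp hnl hP', totalComp_of_of hnm,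
        totalComp_of_of hP, totalComp_of_of hnl, totalComp_of_of hP', ← map_sub, ← map_sub,
        comp_comp_sub_insideTerms hnm hP hnl hP']
      exact LinearMap.map_smul_of_tower (DirectSum.lof K ℕ (HochschildCochain K A) P) _ _

theorem isGradedCommutator_totalBracket :
    IsGradedCommutator (shiftedGrading K (HochschildCochain K A)) (totalComp K A)
      (totalBracket K A) := by
  intro i j x y hx hy
  obtain rfl | ⟨n, f, rfl, rfl⟩ := eq_zero_or_exists_of_mem_shiftedGrading hx
  · simp
  obtain rfl | ⟨m, g, rfl, rfl⟩ := eq_zero_or_exists_of_mem_shiftedGrading hy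
  · simp
  obtain ⟨rfl, rfl⟩ | ⟨N, h⟩ := eq_zero_and_eq_zero_or_exists_add_one_eq_add n m
  · simp only [totalComp_of_zero, LinearMap.zero_apply, smul_zero, sub_zero]
    exact shiftedBilinear_of_zero_of_zero f g
  · rw [totalBracket_of_of h, totalComp_of_of h, totalComp_of_of (h.trans (add_comm n m)),
      bracket, map_sub]
    congr 1
    exact LinearMap.map_smul_of_tower (DirectSum.lof K ℕ (HochschildCochain K A) N) _ _

theorem isGradedLieAlgebra_totalBracket :
    IsGradedLieAlgebra (shiftedGrading K (HochschildCochain K A)) (totalBracket K A) :=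
  (isGradedPreLie_totalComp K A).isGradedLieAlgebra (isGradedCommutator_totalBracket K A)
    (isInternal_shiftedGrading K _)

end HochschildCochain

end TotalCochains

/-! ### The Gerstenhaber bracket on Hochschild cohomology -/

section SubquotientBilinear

variable {R M₁ M₂ M₃ : Type*} [CommRing R] [AddCommGroup M₁] [Module R M₁] [AddCommGroup M₂]
  [Module R M₂] [AddCommGroup M₃] [Module R M₃] {Z₁ B₁ : Submodule R M₁} {Z₂ B₂ : Submodule R M₂}
  {Z₃ B₃ : Submodule R M₃}

/-- The bilinear map on the subquotients `Z / B` induced by a bilinear map which sends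
`Z₁ × Z₂` to `Z₃` and both `B₁ × Z₂` and `Z₁ × B₂` to `B₃`. -/
noncomputable def subquotientBilinear (b : M₁ →ₗ[R] M₂ →ₗ[R] M₃)
    (hZ : ∀ x ∈ Z₁, ∀ y ∈ Z₂, b x y ∈ Z₃) (hB₁ : ∀ x ∈ B₁, ∀ y ∈ Z₂, b x y ∈ B₃)
    (hB₂ : ∀ x ∈ Z₁, ∀ y ∈ B₂, b x y ∈ B₃) :
    Z₁ ⧸ B₁.submoduleOf Z₁ →ₗ[R] Z₂ ⧸ B₂.submoduleOf Z₂ →ₗ[R] Z₃ ⧸ B₃.submoduleOf Z₃ :=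
  have hrange : ∀ x y, b.domRestrict₁₂ Z₁ Z₂ x y ∈ LinearMap.range Z₃.subtype := fun x y =>
    ⟨⟨b x y, hZ x x.2 y y.2⟩, rfl⟩
  let bZ : Z₁ →ₗ[R] Z₂ →ₗ[R] Z₃ :=
    LinearMap.codRestrict₂ (b.domRestrict₁₂ Z₁ Z₂) Z₃.subtype Z₃.subtype_injective hrange
  have bZ_apply (x y) : Z₃.subtype (bZ x y) = b x y :=
    LinearMap.codRestrict₂_apply (b.domRestrict₁₂ Z₁ Z₂) Z₃.subtype Z₃.subtype_injective hrange x y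
  LinearMap.liftQ₂ _ _ (bZ.compr₂ (B₃.submoduleOf Z₃).mkQ)
    (fun x hx => LinearMap.ext fun y => (Submodule.Quotient.mk_eq_zero _).2 <|
      Submodule.mem_comap.2 <| (bZ_apply x y).symm ▸ hB₁ x hx y y.2)
    (fun y hy => LinearMap.ext fun x => (Submodule.Quotient.mk_eq_zero _).2 <|
      Submodule.mem_comap.2 <| (bZ_apply x y).symm ▸ hB₂ x x.2 y hy)

theorem subquotientBilinear_mk_mk (b : M₁ →ₗ[R] M₂ →ₗ[R] M₃)
    (hZ : ∀ x ∈ Z₁, ∀ y ∈ Z₂, b x y ∈ Z₃) (hB₁ : ∀ x ∈ B₁, ∀ y ∈ Z₂, b x y ∈ B₃)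
    (hB₂ : ∀ x ∈ Z₁, ∀ y ∈ B₂, b x y ∈ B₃) (x : Z₁) (y : Z₂) :
    subquotientBilinear b hZ hB₁ hB₂ (Submodule.Quotient.mk x) (Submodule.Quotient.mk y) =
      Submodule.Quotient.mk ⟨b x y, hZ x x.2 y y.2⟩ :=
  congrArg Submodule.Quotient.mk <| Subtype.ext <|
    LinearMap.codRestrict₂_apply (b.domRestrict₁₂ Z₁ Z₂) Z₃.subtype _ _ x y

end SubquotientBilinear

section GerstenhaberBracket

variable {K : Type*} [Field K] {A : Type*} [Ring A] [Algebra K A] {n m N : ℕ}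

namespace HochschildCochain

variable (K A) in
/-- The multiplication of `A` as an element of `C^2(A)`. -/
noncomputable def mulCochain : ⨁ n, HochschildCochain K A n :=
  DirectSum.of _ 2 (MultilinearMap.mkPiAlgebraFin K 2 A)

variable (K A) in
theorem mulCochain_mem : mulCochain K A ∈ shiftedGrading K (HochschildCochain K A) 1 :=
  of_mem_shiftedGrading (by norm_num) _

theorem hochschildDifferential_eq_neg_bracket (h : n + 1 + 1 = n + 2)
    (f : HochschildCochain K A n) :
    hochschildDifferential K A n f = -f.bracket h (MultilinearMap.mkPiAlgebraFin K 2 A) := by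
  have neg_one_pow_smul (k : ℕ) (g : HochschildCochain K A (n + 1)) :
      (-1 : K) ^ k • g = (k : ℤ).negOnePow • g := by
    rw [Units.smul_def, ← Int.cast_smul_eq_zsmul K, Int.cast_negOnePow_natCast]
  have negOnePow_sub_one : ((n : ℤ) - 1).negOnePow = ((n : ℤ) + 1).negOnePow := by
    rw [Int.negOnePow_sub, Int.negOnePow_add]
  simp only [hochschildDifferential, bracket, comp, LinearMap.coe_mk, AddHom.coe_mk,
    Fin.sum_univ_two, neg_one_pow_smul]
  simp only [Nat.cast_add, Nat.cast_one, Int.negOnePow_succ, Units.neg_smul,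
    Finset.sum_neg_distrib, Nat.cast_ofNat, Int.reduceSub, mul_one, negOnePow_sub_one,
    Fin.coe_ofNat_eq_mod, Nat.zero_mod, CharP.cast_eq_zero, zero_mul, Int.negOnePow_zero,
    one_smul, Nat.mod_succ, one_mul, smul_add, smul_neg, smul_smul, neg_mul, Int.units_mul_self,
    neg_neg, neg_sub]
  abel

theorem of_hochschildDifferential (f : HochschildCochain K A n) :
    DirectSum.of _ (n + 1) (hochschildDifferential K A n f) =
      -totalBracket K A (DirectSum.of _ n f) (mulCochain K A) := by
  rw [mulCochain, totalBracket_of_of (n := n) (m := 2) rfl, ← map_neg,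
    hochschildDifferential_eq_neg_bracket]

theorem mem_hochschildCocycles_iff {f : HochschildCochain K A n} :
    f ∈ hochschildCocycles K A n ↔ totalBracket K A (DirectSum.of _ n f) (mulCochain K A) = 0 := by
  rw [← neg_eq_zero, ← of_hochschildDifferential, hochschildCocycles, LinearMap.mem_ker,
    map_eq_zero_iff _ (DirectSum.of_injective _)]

theorem mem_hochschildCoboundaries_iff {f : HochschildCochain K A n} :
    f ∈ hochschildCoboundaries K A n ↔ ∃ x ∈ shiftedGrading K (HochschildCochain K A) (n - 2),
      totalBracket K A x (mulCochain K A) = DirectSum.of _ n f := by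
  constructor
  · intro hf
    obtain _ | n := n
    · obtain rfl : f = 0 := hf
      exact ⟨0, zero_mem _, by simp⟩
    · obtain ⟨g, rfl⟩ := hf
      refine ⟨-DirectSum.of _ n g, neg_mem (of_mem_shiftedGrading (by push_cast; ring) g), ?_⟩
      rw [map_neg, LinearMap.neg_apply, of_hochschildDifferential]
  · rintro ⟨x, hx, hxf⟩
    obtain rfl | ⟨k, g, hk, rfl⟩ := eq_zero_or_exists_of_mem_shiftedGrading hx
    · obtain rfl : f = 0 := DirectSum.of_injective n <| by simpa using hxf.symm
      exact zero_mem _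
    · obtain rfl : n = k + 1 := by omega
      refine ⟨-g, DirectSum.of_injective (k + 1) ?_⟩
      rw [map_neg, map_neg, of_hochschildDifferential, neg_neg, hxf]

theorem bracket_mem_hochschildCocycles (h : N + 1 = n + m) {f : HochschildCochain K A n}
    (hf : f ∈ hochschildCocycles K A n) {g : HochschildCochain K A m}
    (hg : g ∈ hochschildCocycles K A m) : f.bracket h g ∈ hochschildCocycles K A N := by
  rw [mem_hochschildCocycles_iff] at hf hg ⊢
  rw [← totalBracket_of_of h, (isGradedLieAlgebra_totalBracket K A).bracket_bracket
    (of_mem_shiftedGrading rfl f) (of_mem_shiftedGrading rfl g) (mulCochain_mem K A), hf, hg,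
    map_zero, map_zero, LinearMap.zero_apply, smul_zero, add_zero]

theorem bracket_mem_hochschildCoboundaries_left (h : N + 1 = n + m)
    {f : HochschildCochain K A n} (hf : f ∈ hochschildCoboundaries K A n)
    {g : HochschildCochain K A m} (hg : g ∈ hochschildCocycles K A m) :
    f.bracket h g ∈ hochschildCoboundaries K A N := by
  have hL := isGradedLieAlgebra_totalBracket K A
  obtain ⟨x, hx, hxf⟩ := mem_hochschildCoboundaries_iff.1 hf
  have hgm := of_mem_shiftedGrading (K := K) rfl g
  rw [mem_hochschildCocycles_iff] at hg
  refine mem_hochschildCoboundaries_iff.2 ⟨(((m : ℤ) - 1) * 1).negOnePow •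
    totalBracket K A x (DirectSum.of _ m g), ?_, ?_⟩
  · rw [Units.smul_def, show (N : ℤ) - 2 = n - 2 + (m - 1) by omega]
    exact zsmul_mem (hL.bracket_mem hx hgm) _
  · rw [LinearMap.map_smul_of_tower, LinearMap.smul_apply,
      hL.bracket_bracket hx hgm (mulCochain_mem K A), hg, hxf, map_zero, zero_add, smul_smul,
      Int.units_mul_self, one_smul, totalBracket_of_of h]

theorem bracket_mem_hochschildCoboundaries_right (h : N + 1 = n + m)
    {f : HochschildCochain K A n} (hf : f ∈ hochschildCocycles K A n)
    {g : HochschildCochain K A m} (hg : g ∈ hochschildCoboundaries K A m) :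
    f.bracket h g ∈ hochschildCoboundaries K A N := by
  have hL := isGradedLieAlgebra_totalBracket K A
  obtain ⟨x, hx, hxg⟩ := mem_hochschildCoboundaries_iff.1 hg
  have hfm := of_mem_shiftedGrading (K := K) rfl f
  rw [mem_hochschildCocycles_iff] at hf
  refine mem_hochschildCoboundaries_iff.2 ⟨totalBracket K A (DirectSum.of _ n f) x, ?_, ?_⟩
  · rw [show (N : ℤ) - 2 = n - 1 + (m - 2) by omega]
    exact hL.bracket_mem hfm hx
  · rw [hL.bracket_bracket hfm hx (mulCochain_mem K A), hf, hxg, map_zero,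
      LinearMap.zero_apply, smul_zero, add_zero, totalBracket_of_of h]

end HochschildCochain

variable (K A) in
/-- The Gerstenhaber bracket on `HH^*(A)`. -/
noncomputable def gerstenhaberBracket : TotalHochschildCohomology K A →ₗ[K]
    TotalHochschildCohomology K A →ₗ[K] TotalHochschildCohomology K A :=
  shiftedBilinear fun _ _ _ h => subquotientBilinear (HochschildCochain.bracketₗ K A h)
    (fun f hf g hg => (HochschildCochain.bracketₗ_apply h f g).symm ▸
      HochschildCochain.bracket_mem_hochschildCocycles h hf hg)
    (fun f hf g hg => (HochschildCochain.bracketₗ_apply h f g).symm ▸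
      HochschildCochain.bracket_mem_hochschildCoboundaries_left h hf hg)
    (fun f hf g hg => (HochschildCochain.bracketₗ_apply h f g).symm ▸
      HochschildCochain.bracket_mem_hochschildCoboundaries_right h hf hg)

variable (K A) in
theorem isGerstenhaberBracket_gerstenhaberBracket :
    IsGerstenhaberBracket (gerstenhaberBracket K A) where
  zero_zero _ _ _ _ := shiftedBilinear_of_zero_of_zero _ _
  bracket_class h f g hf hg := by
    refine ⟨HochschildCochain.bracket_mem_hochschildCocycles h hf hg, ?_⟩
    refine (shiftedBilinear_of_of h _ _).trans ?_
    simp only [subquotientBilinear_mk_mk, HochschildCochain.bracketₗ_apply]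
    rfl

variable (K A) in
theorem span_hochschildClass : Submodule.span K {x : TotalHochschildCohomology K A |
    ∃ (n : ℕ) (f : HochschildCochain K A n) (hf : f ∈ hochschildCocycles K A n),
      hochschildClass f hf = x} = ⊤ := by
  refine eq_top_iff.2 fun x _ => ?_
  induction x using DirectSum.induction_on with
  | zero => exact zero_mem _
  | of n x =>
    obtain ⟨⟨f, hf⟩, rfl⟩ := Submodule.Quotient.mk_surjective _ x
    exact Submodule.subset_span ⟨n, f, hf, rfl⟩
  | add x y hx hy => exact add_mem (hx trivial) (hy trivial)

namespace IsGerstenhaberBracket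

variable {B : TotalHochschildCohomology K A →ₗ[K]
  TotalHochschildCohomology K A →ₗ[K] TotalHochschildCohomology K A}

theorem eq_gerstenhaberBracket (hB : IsGerstenhaberBracket B) : B = gerstenhaberBracket K A := by
  have hB' := isGerstenhaberBracket_gerstenhaberBracket K A
  refine LinearMap.ext_on (span_hochschildClass K A) ?_
  rintro _ ⟨n, f, hf, rfl⟩
  refine LinearMap.ext_on (span_hochschildClass K A) ?_
  rintro _ ⟨m, g, hg, rfl⟩
  obtain ⟨rfl, rfl⟩ | ⟨N, h⟩ := eq_zero_and_eq_zero_or_exists_add_one_eq_add n m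
  · rw [hB.zero_zero, hB'.zero_zero]
  · exact (hB.bracket_class h f g hf hg).2.trans (hB'.bracket_class h f g hf hg).2.symm

theorem isGradedLieAlgebra (hB : IsGerstenhaberBracket B) :
    IsGradedLieAlgebra (shiftedGrading K (HochschildCohomology K A)) B := by
  refine (HochschildCochain.isGradedLieAlgebra_totalBracket K A).of_subquotient
    (𝓩 := shiftedGrading K fun n => hochschildCocycles K A n) (isInternal_shiftedGrading K _)
    (ι := DirectSum.lmap fun n => (hochschildCocycles K A n).subtype)
    (q := DirectSum.lmap fun n =>
      ((hochschildCoboundaries K A n).submoduleOf (hochschildCocycles K A n)).mkQ)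
    ((DirectSum.lmap_injective _).2 fun n => Submodule.subtype_injective _)
    (lmap_mem_shiftedGrading _) (mem_shiftedGrading_iff_exists_lmap_eq fun _ =>
      Submodule.mkQ_surjective _) ?_
  intro i j x y hx hy
  obtain rfl | ⟨n, f, rfl, rfl⟩ := eq_zero_or_exists_of_mem_shiftedGrading hx
  · exact ⟨0, zero_mem _, by simp⟩
  obtain rfl | ⟨m, g, rfl, rfl⟩ := eq_zero_or_exists_of_mem_shiftedGrading hy
  · exact ⟨0, zero_mem _, by simp⟩
  simp only [DirectSum.lmap_of]
  obtain ⟨rfl, rfl⟩ | ⟨N, h⟩ := eq_zero_and_eq_zero_or_exists_add_one_eq_add n m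
  · refine ⟨0, zero_mem _, ?_, ?_⟩
    · exact (map_zero _).trans (shiftedBilinear_of_zero_of_zero _ _).symm
    · exact (map_zero _).trans (hB.zero_zero _ _ f.2 g.2).symm
  · obtain ⟨hfg, hBfg⟩ := hB.bracket_class h f g f.2 g.2
    refine ⟨DirectSum.of _ N ⟨_, hfg⟩, of_mem_shiftedGrading (by omega) _, ?_, ?_⟩
    · exact (DirectSum.lmap_of _ _ _).trans (HochschildCochain.totalBracket_of_of h _ _).symm
    · exact (DirectSum.lmap_of _ _ _).trans hBfg.symm

end IsGerstenhaberBracket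

variable (K A) in
theorem existsUnique_isGerstenhaberBracket :
    ∃! B, IsGerstenhaberBracket (K := K) (A := A) B :=
  ⟨_, isGerstenhaberBracket_gerstenhaberBracket K A, fun _ hB => hB.eq_gerstenhaberBracket⟩

end GerstenhaberBracket

/-! ### Inhomogeneous cocycles and group cohomology -/

section GroupCohomology

open CategoryTheory

variable {k G : Type u} [CommRing k] [Group G] (A : Rep.{u} k G) (n : ℕ)

/-- Inhomogeneous cocycles, as a submodule of the inhomogeneous cochains. -/
noncomputable def groupCocycles : Submodule k ((Fin n → G) → A) :=
  LinearMap.ker (inhomogeneousCochains.d A n).hom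

/-- Inhomogeneous coboundaries, as a submodule of the inhomogeneous cochains. -/
noncomputable def groupCoboundaries : (n : ℕ) → Submodule k ((Fin n → G) → A)
  | 0 => ⊥
  | n + 1 => LinearMap.range (inhomogeneousCochains.d A n).hom

theorem iCocycles_injective : Function.Injective (groupCohomology.iCocycles A n) :=
  (ModuleCat.mono_iff_injective _).1 inferInstance

/-- The comparison of inhomogeneous cocycles with the cycles of the complex of inhomogeneous
cochains. -/
noncomputable def groupCocyclesEquiv : groupCocycles A n ≃ₗ[k] groupCohomology.cocycles A n :=
  .symm <| .ofBijective ((groupCohomology.iCocycles A n).hom.codRestrict _ fun z => by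
      have h := (groupCohomology.inhomogeneousCochains A).iCycles_d n (n + 1)
      rw [groupCohomology.inhomogeneousCochains.d_def] at h
      exact ConcreteCategory.congr_hom h z)
    ⟨fun _ _ h => iCocycles_injective A n (congrArg Subtype.val h),
      fun α => ⟨groupCohomology.cocyclesMk α.1 α.2,
        Subtype.ext (groupCohomology.iCocycles_mk α.1 α.2)⟩⟩

variable {A n}

theorem iCocycles_groupCocyclesEquiv (α : groupCocycles A n) :
    groupCohomology.iCocycles A n (groupCocyclesEquiv A n α) = α :=
  congrArg Subtype.val ((groupCocyclesEquiv A n).symm_apply_apply α)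

theorem groupCocyclesEquiv_apply (α : groupCocycles A n) :
    groupCocyclesEquiv A n α = groupCohomology.cocyclesMk α.1 α.2 :=
  iCocycles_injective A n <|
    (iCocycles_groupCocyclesEquiv α).trans (groupCohomology.iCocycles_mk α.1 α.2).symm

theorem groupCohomology_π_eq_zero_iff {i : ℕ} (hi : (ComplexShape.up ℕ).prev n = i)
    (z : groupCohomology.cocycles A n) :
    groupCohomology.π A n z = 0 ↔ ∃ w, groupCohomology.toCocycles A i n w = z := by
  have hzero := (groupCohomology.inhomogeneousCochains A).toCycles_comp_homologyπ i n
  have hexact := ShortComplex.exact_of_g_is_cokernel (ShortComplex.mk _ _ hzero)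
    ((groupCohomology.inhomogeneousCochains A).homologyIsCokernel i n hi)
  refine ⟨(ShortComplex.moduleCat_exact_iff _).1 hexact z, ?_⟩
  rintro ⟨w, rfl⟩
  exact ConcreteCategory.congr_hom hzero w

theorem exists_toCocycles_eq_iff (z : groupCohomology.cocycles A n) :
    (∃ w, groupCohomology.toCocycles A ((ComplexShape.up ℕ).prev n) n w = z) ↔
      groupCohomology.iCocycles A n z ∈ groupCoboundaries A n := by
  obtain _ | n := n
  · have hzero : groupCohomology.toCocycles A ((ComplexShape.up ℕ).prev 0) 0 = 0 :=
      HomologicalComplex.toCycles_eq_zero _ (by simp)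
    rw [hzero]
    refine ⟨?_, fun hz => ⟨0, iCocycles_injective A 0 (.trans (map_zero _) (.symm hz))⟩⟩
    rintro ⟨w, rfl⟩
    exact map_zero (groupCohomology.iCocycles A 0).hom
  · rw [show (ComplexShape.up ℕ).prev (n + 1) = n by simp]
    have hd := (groupCohomology.inhomogeneousCochains A).toCycles_i n (n + 1)
    rw [groupCohomology.inhomogeneousCochains.d_def] at hd
    have i_toCocycles (w) : groupCohomology.iCocycles A (n + 1)
        (groupCohomology.toCocycles A n (n + 1) w) = inhomogeneousCochains.d A n w :=
      ConcreteCategory.congr_hom hd w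
    refine exists_congr fun w => ⟨?_, fun hw => iCocycles_injective A _ ?_⟩
    · rintro rfl
      exact (i_toCocycles w).symm
    · exact (i_toCocycles w).trans hw

variable (A n) in
/-- The cohomology class of an inhomogeneous cocycle. -/
noncomputable def groupClass : groupCocycles A n →ₗ[k] groupCohomology A n :=
  (groupCohomology.π A n).hom ∘ₗ (groupCocyclesEquiv A n).toLinearMap

theorem groupClass_apply (α : groupCocycles A n) :
    groupClass A n α = groupCohomology.π A n (groupCohomology.cocyclesMk α.1 α.2) :=
  congrArg (groupCohomology.π A n).hom (groupCocyclesEquiv_apply α)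

variable (A n) in
theorem groupClass_surjective : Function.Surjective (groupClass A n) := by
  intro x
  induction x using groupCohomology_induction_on with
  | h z => exact ⟨(groupCocyclesEquiv A n).symm z, by simp [groupClass]⟩

theorem groupClass_eq_zero_iff (α : groupCocycles A n) :
    groupClass A n α = 0 ↔ (α : (Fin n → G) → A) ∈ groupCoboundaries A n := by
  rw [← iCocycles_groupCocyclesEquiv α, ← exists_toCocycles_eq_iff]
  exact groupCohomology_π_eq_zero_iff rfl _

end GroupCohomology

/-! ### Hochschild cochains of a group algebra -/

section SubstitutionInMonoids

variable {X Y : Type*} {n m N : ℕ}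

theorem comp_substAt (φ : X → Y) (h : N + 1 = n + m) (i : Fin n) (x : Fin N → X) (a : X) :
    (fun j => φ (substAt h i x a j)) = substAt h i (fun j => φ (x j)) (φ a) := by
  funext j
  simp only [substAt]
  split_ifs <;> rfl

theorem contractNth_castSucc_eq_substAt [Mul X] (i : Fin n) (x : Fin (n + 1) → X) :
    Fin.contractNth i.castSucc (· * ·) x =
      substAt (m := 2) rfl i x (x i.castSucc * x i.succ) := by
  funext j
  simp only [substAt, Fin.contractNth, Fin.val_castSucc]
  split_ifs with h₁ h₂
  · rfl
  · obtain rfl : j = i := Fin.ext h₂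
    rfl
  · rfl

theorem contractNth_last [Mul X] (x : Fin (n + 1) → X) :
    Fin.contractNth (Fin.last n) (· * ·) x = fun j => x j.castSucc := by
  funext j
  rw [Fin.contractNth_apply_of_lt _ _ _ _ (by simp)]

theorem prod_substAt [CommMonoid X] (h : N + 1 = n + m) (i : Fin n) (x : Fin N → X) (y : X) :
    ∏ j, substAt h i x ((∏ k, blockAt h i x k) * y) j = (∏ j, x j) * y := by
  obtain ⟨i, hi⟩ := i
  obtain ⟨r, rfl⟩ : ∃ r, n = i + (1 + r) := ⟨n - i - 1, by omega⟩
  obtain rfl : N = i + (m + r) := by omega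
  generalize ha : (∏ k, blockAt h ⟨i, hi⟩ x k) * y = a
  have block (k : Fin m) : blockAt h ⟨i, hi⟩ x k = x (.natAdd i (.castAdd r k)) := rfl
  have before (j : Fin i) :
      substAt h ⟨i, hi⟩ x a (.castAdd (1 + r) j) = x (.castAdd (m + r) j) := by
    simp only [substAt, Fin.val_castAdd, j.isLt, dif_pos]
    rfl
  have center (j : Fin 1) : substAt h ⟨i, hi⟩ x a (.natAdd i (.castAdd r j)) = a := by
    simp [substAt]
  have after (j : Fin r) :
      substAt h ⟨i, hi⟩ x a (.natAdd i (.natAdd 1 j)) = x (.natAdd i (.natAdd m j)) := by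
    simp only [substAt, Fin.val_natAdd]
    rw [dif_neg (by omega), dif_neg (by omega)]
    congr 1
    ext
    simp only [Fin.val_natAdd]
    omega
  simp only [Fin.prod_univ_add, before, center, after, Fin.prod_univ_one]
  simp only [← ha, block, mul_assoc, mul_comm y]

theorem prod_contractNth_castSucc [CommMonoid X] (i : Fin n) (x : Fin (n + 1) → X) :
    ∏ j, Fin.contractNth i.castSucc (· * ·) x j = ∏ j, x j := by
  have hprod := prod_substAt (m := 2) rfl i x 1
  rw [mul_one, mul_one, Fin.prod_univ_two] at hprod
  rw [contractNth_castSucc_eq_substAt]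
  exact hprod

end SubstitutionInMonoids

section GroupAlgebra

variable {K G : Type*} [Field K] [CommGroup G] {n m N : ℕ}

theorem HochschildCochain.ext_single {f g : HochschildCochain K (MonoidAlgebra K G) n}
    (h : ∀ x : Fin n → G, f (fun i => MonoidAlgebra.single (x i) 1) =
      g (fun i => MonoidAlgebra.single (x i) 1)) : f = g := by
  refine Module.Basis.ext_multilinear (fun _ => MonoidAlgebra.basis G K) fun x => ?_
  simpa using h x

/-- The component at `y ∈ G` of a Hochschild cochain `f` of `KG`: its value at `(x_0, …, x_{n-1})`
is the coefficient of `x_0 ⋯ x_{n-1} y` in `f(x_0, …, x_{n-1})`. -/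
noncomputable def coeffCochain (n : ℕ) (y : G) :
    HochschildCochain K (MonoidAlgebra K G) n →ₗ[K] ((Fin n → G) → K) where
  toFun f x := (f fun i => MonoidAlgebra.single (x i) 1).coeff ((∏ i, x i) * y)
  map_add' _ _ := rfl
  map_smul' _ _ := rfl

theorem coeffCochain_apply (y : G) (f : HochschildCochain K (MonoidAlgebra K G) n)
    (x : Fin n → G) : coeffCochain n y f x =
      (f fun i => MonoidAlgebra.single (x i) 1).coeff ((∏ i, x i) * y) := rfl

theorem HochschildCochain.ext_coeffCochain {f g : HochschildCochain K (MonoidAlgebra K G) n}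
    (h : ∀ y, coeffCochain n y f = coeffCochain n y g) : f = g := by
  refine HochschildCochain.ext_single fun x => MonoidAlgebra.coeff_injective ?_
  ext z
  simpa only [coeffCochain_apply, mul_inv_cancel_left] using congrFun (h ((∏ i, x i)⁻¹ * z)) x

/-- The Hochschild cochain `(x_0, …, x_{n-1}) ↦ α(x_0, …, x_{n-1}) x_0 ⋯ x_{n-1} y` of `KG`
attached to `α : G^n → K` and `y ∈ G`, linearly in `α`. -/
noncomputable def monomialCochain (n : ℕ) (y : G) :
    ((Fin n → G) → K) →ₗ[K] HochschildCochain K (MonoidAlgebra K G) n :=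
  PiTensorProduct.lift.symm.toLinearMap ∘ₗ
    ((Basis.piTensorProduct fun _ => MonoidAlgebra.basis G K).constr K).toLinearMap ∘ₗ
      LinearMap.pi fun x => MonoidAlgebra.lsingle ((∏ i, x i) * y) ∘ₗ LinearMap.proj x

theorem monomialCochain_apply_single (y : G) (α : (Fin n → G) → K) (x : Fin n → G) :
    monomialCochain n y α (fun i => MonoidAlgebra.single (x i) 1) =
      MonoidAlgebra.single ((∏ i, x i) * y) (α x) := by
  have hbasis := ((Basis.piTensorProduct fun _ : Fin n => MonoidAlgebra.basis G K).constr_basis K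
    (fun x => MonoidAlgebra.single ((∏ i, x i) * y) (α x)) x)
  simp only [Basis.piTensorProduct_apply, MonoidAlgebra.basis_apply] at hbasis
  exact hbasis

theorem coeffCochain_monomialCochain_self (y : G) (α : (Fin n → G) → K) :
    coeffCochain n y (monomialCochain n y α) = α := by
  funext x
  rw [coeffCochain_apply, monomialCochain_apply_single, MonoidAlgebra.coeff_single,
    Finsupp.single_eq_same]

theorem coeffCochain_monomialCochain_of_ne {y z : G} (hyz : y ≠ z) (α : (Fin n → G) → K) :
    coeffCochain n z (monomialCochain n y α) = 0 := by
  funext x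
  rw [coeffCochain_apply, monomialCochain_apply_single, MonoidAlgebra.coeff_single,
    Finsupp.single_eq_of_ne' (mt mul_left_cancel hyz), Pi.zero_apply]

theorem coeffCochain_sum_monomialCochain [Fintype G] (α : G → (Fin n → G) → K) (z : G) :
    coeffCochain n z (∑ y, monomialCochain n y (α y)) = α z := by
  rw [map_sum, Fintype.sum_eq_single z fun y hyz => coeffCochain_monomialCochain_of_ne hyz _,
    coeffCochain_monomialCochain_self]

theorem compAt_monomialCochain (h : N + 1 = n + m) (i : Fin n) (α : (Fin n → G) → K) (x : G)
    (β : (Fin m → G) → K) (y : G) :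
    (monomialCochain n x α).compAt h i (monomialCochain m y β) =
      monomialCochain N (x * y) (fun z =>
        α (substAt h i z ((∏ k, blockAt h i z k) * y)) * β (blockAt h i z)) := by
  refine HochschildCochain.ext_single fun z => ?_
  have single_eq_smul (g : G) (c : K) :
      MonoidAlgebra.single g c = c • MonoidAlgebra.single g (1 : K) := by
    rw [MonoidAlgebra.smul_single, smul_eq_mul, mul_one]
  have inner : monomialCochain m y β (blockAt h i fun j => MonoidAlgebra.single (z j) 1) =
      β (blockAt h i z) • MonoidAlgebra.single ((∏ k, blockAt h i z k) * y) (1 : K) :=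
    (monomialCochain_apply_single y β (blockAt h i z)).trans (single_eq_smul _ _)
  rw [HochschildCochain.compAt_apply, inner, substAt_eq_update h i _ (_ • _) (a' := 0),
    MultilinearMap.map_update_smul, ← substAt_eq_update,
    ← comp_substAt (fun g => MonoidAlgebra.single g (1 : K)), monomialCochain_apply_single,
    monomialCochain_apply_single, prod_substAt, MonoidAlgebra.smul_single, smul_eq_mul,
    mul_comm (β _), mul_assoc, mul_comm y]

end GroupAlgebra

section GroupAlgebraBracket

variable {K G : Type u} [Field K] [CommGroup G] {n m N : ℕ}

theorem inhomogeneousCochains_d_trivial_apply (α : (Fin n → G) → K) (x : Fin (n + 1) → G) :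
    inhomogeneousCochains.d (Rep.trivial K G K) n α x = α (fun j => x j.succ) +
      ∑ i : Fin n, (-1 : K) ^ ((i : ℕ) + 1) * α (Fin.contractNth i.castSucc (· * ·) x) +
        (-1 : K) ^ (n + 1) * α (fun j => x j.castSucc) := by
  refine (inhomogeneousCochains.d_hom_apply _ _ _ _).trans ?_
  rw [Fin.sum_univ_castSucc, contractNth_last, add_assoc]
  rfl

theorem coeffCochain_hochschildDifferential (y : G)
    (f : HochschildCochain K (MonoidAlgebra K G) n) :
    coeffCochain (n + 1) y (hochschildDifferential K (MonoidAlgebra K G) n f) =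
      inhomogeneousCochains.d (Rep.trivial K G K) n (coeffCochain n y f) := by
  funext x
  rw [coeffCochain_apply, hochschildDifferential_apply, inhomogeneousCochains_d_trivial_apply,
    MonoidAlgebra.coeff_add, Finsupp.add_apply, MonoidAlgebra.coeff_add, Finsupp.add_apply]
  congr 2
  · rw [MonoidAlgebra.coeff_single_mul_apply, one_mul, Fin.prod_univ_succ, mul_assoc,
      inv_mul_cancel_left, coeffCochain_apply]
  · rw [MonoidAlgebra.coeff_sum, Finsupp.finsetSum_apply]
    refine Finset.sum_congr rfl fun i _ => ?_
    rw [coeffCochain_apply, prod_contractNth_castSucc, contractNth_castSucc_eq_substAt,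
      contractNth_castSucc_eq_substAt, comp_substAt (fun g => MonoidAlgebra.single g (1 : K)),
      MonoidAlgebra.single_mul_single, one_mul]
    rfl
  · rw [MonoidAlgebra.coeff_smul, Finsupp.smul_apply, MonoidAlgebra.coeff_mul_single_apply,
      mul_one, Fin.prod_univ_castSucc, mul_right_comm, mul_inv_cancel_right]
    rfl

theorem hochschildDifferential_monomialCochain (y : G) (α : (Fin n → G) → K) :
    hochschildDifferential K (MonoidAlgebra K G) n (monomialCochain n y α) =
      monomialCochain (n + 1) y (inhomogeneousCochains.d (Rep.trivial K G K) n α) := by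
  refine HochschildCochain.ext_coeffCochain fun z => ?_
  rw [coeffCochain_hochschildDifferential]
  obtain rfl | hyz := eq_or_ne y z
  · rw [coeffCochain_monomialCochain_self, coeffCochain_monomialCochain_self]
  · rw [coeffCochain_monomialCochain_of_ne hyz, coeffCochain_monomialCochain_of_ne hyz]
    exact map_zero (inhomogeneousCochains.d (Rep.trivial K G K) n).hom

theorem monomialCochain_mem_hochschildCocycles_iff {y : G} {α : (Fin n → G) → K} :
    monomialCochain n y α ∈ hochschildCocycles K (MonoidAlgebra K G) n ↔ IsGroupCocycle α := by
  rw [hochschildCocycles, LinearMap.mem_ker, hochschildDifferential_monomialCochain,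
    map_eq_zero_iff _ (Function.LeftInverse.injective (coeffCochain_monomialCochain_self y)),
    IsGroupCocycle]

theorem comp_monomialCochain (h : N + 1 = n + m) (α : (Fin n → G) → K) (x : G)
    (β : (Fin m → G) → K) (y : G) :
    (monomialCochain n x α).comp h (monomialCochain m y β) =
      monomialCochain N (x * y) (gammaSum h α β y) := by
  rw [HochschildCochain.comp, gammaSum, map_sum]
  refine Finset.sum_congr rfl fun i _ => ?_
  rw [compAt_monomialCochain, LinearMap.map_smul_of_tower, mul_comm (i : ℤ)]
  rfl

theorem bracket_monomialCochain (h : N + 1 = n + m) (α : (Fin n → G) → K) (x : G)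
    (β : (Fin m → G) → K) (y : G) :
    (monomialCochain n x α).bracket h (monomialCochain m y β) =
      monomialCochain N (x * y) (bracketCoeff h α x β y) := by
  rw [HochschildCochain.bracket, bracketCoeff, map_sub, LinearMap.map_smul_of_tower,
    comp_monomialCochain, comp_monomialCochain, mul_comm y x]

end GroupAlgebraBracket

/-! ### The isomorphism of Hochschild and group cohomology -/

section TensorMonoidAlgebra

variable (K G V : Type*) [CommSemiring K] [AddCommMonoid V] [Module K V]

open Classical in
/-- The isomorphism `V ⊗ KG ≃ ⨁_{y ∈ G} V` given by the coefficients in `V` of the `y ∈ G`. -/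
noncomputable def tensorMonoidAlgebraEquiv : V ⊗[K] MonoidAlgebra K G ≃ₗ[K] G →₀ V :=
  TensorProduct.congr (.refl K V) (MonoidAlgebra.coeffLinearEquiv K) ≪≫ₗ
    TensorProduct.finsuppScalarRight K K V G

variable {K G V}

theorem tensorMonoidAlgebraEquiv_symm_single (y : G) (v : V) :
    (tensorMonoidAlgebraEquiv K G V).symm (Finsupp.single y v) =
      v ⊗ₜ[K] MonoidAlgebra.single y (1 : K) := by
  simp [tensorMonoidAlgebraEquiv]

end TensorMonoidAlgebra

section CohomologyIso

variable {K G : Type u} [Field K] [CommGroup G] {n : ℕ}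

theorem coeffCochain_mem_groupCocycles {f : HochschildCochain K (MonoidAlgebra K G) n}
    (hf : f ∈ hochschildCocycles K (MonoidAlgebra K G) n) (y : G) :
    coeffCochain n y f ∈ groupCocycles (Rep.trivial K G K) n := by
  refine LinearMap.mem_ker.2 ((coeffCochain_hochschildDifferential y f).symm.trans ?_)
  rw [LinearMap.mem_ker.1 hf, map_zero]

theorem mem_hochschildCoboundaries_iff_coeffCochain_mem [Finite G]
    {f : HochschildCochain K (MonoidAlgebra K G) n} :
    f ∈ hochschildCoboundaries K (MonoidAlgebra K G) n ↔
      ∀ y, coeffCochain n y f ∈ groupCoboundaries (Rep.trivial K G K) n := by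
  have := Fintype.ofFinite G
  obtain _ | n := n
  · refine ⟨?_, fun hf => HochschildCochain.ext_coeffCochain fun y => ?_⟩
    · rintro rfl y
      exact map_zero _
    · exact (hf y).trans (map_zero _).symm
  · refine ⟨?_, fun hf => ?_⟩
    · rintro ⟨g, rfl⟩ y
      exact ⟨coeffCochain n y g, (coeffCochain_hochschildDifferential y g).symm⟩
    · choose β hβ using hf
      refine ⟨∑ y, monomialCochain n y (β y), ?_⟩
      refine HochschildCochain.ext_coeffCochain fun z => ?_
      rw [coeffCochain_hochschildDifferential, coeffCochain_sum_monomialCochain]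
      exact hβ z

variable (K G n) in
/-- The family, indexed by `y ∈ G`, of the group cohomology classes of the components of a
Hochschild cocycle of `KG`. -/
noncomputable def componentClasses : hochschildCocycles K (MonoidAlgebra K G) n →ₗ[K]
    (G → groupCohomology (Rep.trivial K G K) n) :=
  LinearMap.pi fun y => groupClass (Rep.trivial K G K) n ∘ₗ
    (coeffCochain n y).restrict fun _ hf => coeffCochain_mem_groupCocycles hf y

theorem componentClasses_apply (f : hochschildCocycles K (MonoidAlgebra K G) n) (y : G) :
    componentClasses K G n f y =
      groupClass (Rep.trivial K G K) n ⟨_, coeffCochain_mem_groupCocycles f.2 y⟩ := rfl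

theorem componentClasses_monomialCochain [DecidableEq G] (y : G) {α : (Fin n → G) → K}
    (hα : IsGroupCocycle α) :
    componentClasses K G n
        ⟨monomialCochain n y α, monomialCochain_mem_hochschildCocycles_iff.2 hα⟩ =
      Pi.single y (groupClass (Rep.trivial K G K) n ⟨α, hα⟩) := by
  funext z
  obtain rfl | hyz := eq_or_ne y z
  · simp only [componentClasses_apply, coeffCochain_monomialCochain_self, Pi.single_eq_same]
  · simp only [componentClasses_apply, coeffCochain_monomialCochain_of_ne hyz,
      Pi.single_eq_of_ne' hyz]
    exact map_zero _

variable (K G n) in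
theorem ker_componentClasses [Finite G] : LinearMap.ker (componentClasses K G n) =
    (hochschildCoboundaries K (MonoidAlgebra K G) n).submoduleOf
      (hochschildCocycles K (MonoidAlgebra K G) n) := by
  ext f
  rw [LinearMap.mem_ker, funext_iff, Submodule.submoduleOf, Submodule.mem_comap,
    Submodule.subtype_apply, mem_hochschildCoboundaries_iff_coeffCochain_mem]
  exact forall_congr' fun y => groupClass_eq_zero_iff _

variable (K G n) in
theorem componentClasses_surjective [Finite G] :
    Function.Surjective (componentClasses K G n) := by
  have := Fintype.ofFinite G
  intro v
  choose α hα using fun y => groupClass_surjective (Rep.trivial K G K) n (v y)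
  refine ⟨⟨∑ y, monomialCochain n y (α y : (Fin n → G) → K), sum_mem fun y _ =>
    monomialCochain_mem_hochschildCocycles_iff.2 (α y).2⟩, funext fun z => ?_⟩
  simp only [componentClasses_apply, coeffCochain_sum_monomialCochain]
  exact hα z

variable (K G n) in
/-- The isomorphism `HH^n(KG) ≃ H^n(G, K) ⊗ KG` which sends the class of a cocycle with
components `α_y` to `∑ y, [α_y] ⊗ y`. -/
noncomputable def hochschildCohomologyEquiv [Finite G] :
    HochschildCohomology K (MonoidAlgebra K G) n ≃ₗ[K] GroupCohomologyTensor K G n :=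
  (Submodule.quotEquivOfEq _ _ (ker_componentClasses K G n).symm) ≪≫ₗ
    (componentClasses K G n).quotKerEquivOfSurjective (componentClasses_surjective K G n) ≪≫ₗ
    (Finsupp.linearEquivFunOnFinite K _ G).symm ≪≫ₗ (tensorMonoidAlgebraEquiv K G _).symm

theorem hochschildCohomologyEquiv_mk_monomialCochain [Finite G] (y : G) {α : (Fin n → G) → K}
    (hα : IsGroupCocycle α) :
    hochschildCohomologyEquiv K G n (Submodule.Quotient.mk
        ⟨monomialCochain n y α, monomialCochain_mem_hochschildCocycles_iff.2 hα⟩) =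
      groupClass (Rep.trivial K G K) n ⟨α, hα⟩ ⊗ₜ[K] MonoidAlgebra.single y (1 : K) := by
  classical
  rw [← tensorMonoidAlgebraEquiv_symm_single, ← Finsupp.linearEquivFunOnFinite_symm_single K,
    ← componentClasses_monomialCochain]
  rfl

variable (K G) in
/-- The isomorphism `HH^*(KG) ≃ H^*(G, K) ⊗ KG`. -/
noncomputable def totalHochschildCohomologyEquiv [Finite G] :
    TotalHochschildCohomology K (MonoidAlgebra K G) ≃ₗ[K] TotalGroupCohomologyTensor K G :=
  DirectSum.congrLinearEquiv fun n => hochschildCohomologyEquiv K G n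

theorem totalHochschildCohomologyEquiv_hochschildClass [Finite G] (y : G) {α : (Fin n → G) → K}
    (hα : IsGroupCocycle α) :
    totalHochschildCohomologyEquiv K G (hochschildClass (monomialCochain n y α)
      (monomialCochain_mem_hochschildCocycles_iff.2 hα)) = tensorClass α hα y := by
  refine (DirectSum.lmap_lof
    (fun n => (hochschildCohomologyEquiv K G n).toLinearMap) n _).trans ?_
  rw [LinearEquiv.coe_coe, hochschildCohomologyEquiv_mk_monomialCochain y hα, groupClass_apply]
  rfl

theorem totalHochschildCohomologyEquiv_mem_shiftedGrading_iff [Finite G] (k : ℤ)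
    (x : TotalHochschildCohomology K (MonoidAlgebra K G)) :
    totalHochschildCohomologyEquiv K G x ∈ shiftedGrading K (GroupCohomologyTensor K G) k ↔
      x ∈ shiftedGrading K (HochschildCohomology K (MonoidAlgebra K G)) k :=
  forall₂_congr fun n _ => (hochschildCohomologyEquiv K G n).map_eq_zero_iff

end CohomologyIso

section TransferredBracket

variable (K G : Type u) [Field K] [CommGroup G]

theorem span_tensorClass : Submodule.span K {x : TotalGroupCohomologyTensor K G |
    ∃ (n : ℕ) (α : (Fin n → G) → K) (hα : IsGroupCocycle α) (y : G),
      tensorClass α hα y = x} = ⊤ := by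
  refine eq_top_iff.2 fun x _ => ?_
  induction x using DirectSum.induction_on with
  | zero => exact zero_mem _
  | add x y hx hy => exact add_mem (hx trivial) (hy trivial)
  | of n x =>
    obtain ⟨v, rfl⟩ := (tensorMonoidAlgebraEquiv K G _).symm.surjective x
    induction v using Finsupp.induction_linear with
    | zero => simp
    | add v w hv hw =>
      rw [map_add, map_add]
      exact add_mem (hv trivial) (hw trivial)
    | single y v =>
      obtain ⟨α, rfl⟩ := groupClass_surjective _ n v
      rw [tensorMonoidAlgebraEquiv_symm_single, groupClass_apply]
      exact Submodule.subset_span ⟨n, α, α.2, y, rfl⟩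

variable [Finite G]

/-- The bracket on `H^*(G, K) ⊗ KG` obtained from the Gerstenhaber bracket on `HH^*(KG)` by
transport of structure. -/
noncomputable def transferredBracket : TotalGroupCohomologyTensor K G →ₗ[K]
    TotalGroupCohomologyTensor K G →ₗ[K] TotalGroupCohomologyTensor K G :=
  ((gerstenhaberBracket K (MonoidAlgebra K G)).compl₁₂
    (totalHochschildCohomologyEquiv K G).symm.toLinearMap
    (totalHochschildCohomologyEquiv K G).symm.toLinearMap).compr₂
      (totalHochschildCohomologyEquiv K G).toLinearMap

theorem isGradedLieIso_totalHochschildCohomologyEquiv :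
    IsGradedLieIso (shiftedGrading K (HochschildCohomology K (MonoidAlgebra K G)))
      (gerstenhaberBracket K (MonoidAlgebra K G)) (shiftedGrading K (GroupCohomologyTensor K G))
      (transferredBracket K G) (totalHochschildCohomologyEquiv K G) where
  mem_iff := totalHochschildCohomologyEquiv_mem_shiftedGrading_iff
  map_bracket x y := by simp [transferredBracket]

theorem isTransferredBracket_transferredBracket :
    IsTransferredBracket (transferredBracket K G) := by
  have hB := isGerstenhaberBracket_gerstenhaberBracket K (MonoidAlgebra K G)
  have map_bracket := (isGradedLieIso_totalHochschildCohomologyEquiv K G).map_bracket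
  refine ⟨fun α β hα hβ x y => ?_, fun h α β hα hβ x y => ?_⟩
  · rw [← totalHochschildCohomologyEquiv_hochschildClass x hα,
      ← totalHochschildCohomologyEquiv_hochschildClass y hβ, ← map_bracket, hB.zero_zero, map_zero]
  · obtain ⟨hαβ, hbracket⟩ := hB.bracket_class h (monomialCochain _ x α) (monomialCochain _ y β)
      (monomialCochain_mem_hochschildCocycles_iff.2 hα)
      (monomialCochain_mem_hochschildCocycles_iff.2 hβ)
    simp only [bracket_monomialCochain] at hαβ hbracket
    refine ⟨monomialCochain_mem_hochschildCocycles_iff.1 hαβ, ?_⟩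
    rw [← totalHochschildCohomologyEquiv_hochschildClass x hα,
      ← totalHochschildCohomologyEquiv_hochschildClass y hβ, ← map_bracket, hbracket,
      totalHochschildCohomologyEquiv_hochschildClass]

variable {K G}

theorem IsTransferredBracket.eq_transferredBracket {B : TotalGroupCohomologyTensor K G →ₗ[K]
    TotalGroupCohomologyTensor K G →ₗ[K] TotalGroupCohomologyTensor K G}
    (hB : IsTransferredBracket B) : B = transferredBracket K G := by
  have hB' := isTransferredBracket_transferredBracket K G
  refine LinearMap.ext_on (span_tensorClass K G) ?_
  rintro _ ⟨n, α, hα, x, rfl⟩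
  refine LinearMap.ext_on (span_tensorClass K G) ?_
  rintro _ ⟨m, β, hβ, y, rfl⟩
  obtain ⟨rfl, rfl⟩ | ⟨N, h⟩ := eq_zero_and_eq_zero_or_exists_add_one_eq_add n m
  · rw [hB.zero_zero, hB'.zero_zero]
  · exact (hB.bracket_class h α β hα hβ x y).2.trans (hB'.bracket_class h α β hα hβ x y).2.symm

variable (K G) in
theorem existsUnique_isTransferredBracket : ∃! B, IsTransferredBracket (K := K) (G := G) B :=
  ⟨_, isTransferredBracket_transferredBracket K G, fun _ hB => hB.eq_transferredBracket⟩

end TransferredBracket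

theorem mainTheorem3 (K G : Type u) [Field K] [CommGroup G] [Finite G] :
    (∃! B, IsTransferredBracket (K := K) (G := G) B) ∧
    (∃! B', IsGerstenhaberBracket (K := K) (A := MonoidAlgebra K G) B') ∧
    ∀ B B', IsTransferredBracket (K := K) (G := G) B →
      IsGerstenhaberBracket (K := K) (A := MonoidAlgebra K G) B' →
      IsGradedLieAlgebra (shiftedGrading K (GroupCohomologyTensor K G)) B ∧
      IsGradedLieAlgebra (shiftedGrading K (HochschildCohomology K (MonoidAlgebra K G))) B' ∧
      ∃ e : TotalHochschildCohomology K (MonoidAlgebra K G) ≃ₗ[K] TotalGroupCohomologyTensor K G,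
        IsGradedLieIso (shiftedGrading K (HochschildCohomology K (MonoidAlgebra K G))) B'
          (shiftedGrading K (GroupCohomologyTensor K G)) B e := by
  refine ⟨existsUnique_isTransferredBracket K G,
    existsUnique_isGerstenhaberBracket K (MonoidAlgebra K G), fun B B' hB hB' => ?_⟩
  have hL := hB'.isGradedLieAlgebra
  obtain rfl := hB.eq_transferredBracket
  obtain rfl := hB'.eq_gerstenhaberBracket
  have he := isGradedLieIso_totalHochschildCohomologyEquiv K G
  exact ⟨he.isGradedLieAlgebra hL (isInternal_shiftedGrading K _), hL, _, he⟩
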